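/- **Theorem (List decoding capacity).** Let $\mathcal X,\mathcal S,\mathcal Y$ be finite alphabets, $W:\mathcal X\times\mathcal S\to\mathcal Y$ a function acting letterwise on vectors, and let $\lambda_x\subseteq\Delta(\mathcal X)$ and $\lambda_s\subseteq\Delta(\mathcal S)$ be nonempty closed convex sets of probability vectors. The type $\tau_v$ of a vector $v$ is its empirical distribution; inputs $x\in\mathcal X^n$ are admissible if $\tau_x\in\lambda_x$, noise vectors $s\in\mathcal S^n$ if $\tau_s\in\lambda_s$. Let $\mathcal N\subseteq\mathbb N$ be a set of blocklengths along which types are asymptotically dense in $\lambda_x$ and in $\lambda_s$: every point of $\lambda_x$ is the limit, as $n\to\infty$ in $\mathcal N$, of types of length-$n$ vectors that belong to $\lambda_x$, and likewise for $\lambda_s$. (For instance, $\mathcal N=\mathbb N$ works when both sets have nonempty interior relative to the simplex.) All logarithms are to base 2. For $P\in\lambda_x$ put $I_{\min}(P)=\min I(x;y)$, the minimum over all conditional distributions $P_{s|x}$ for which the $s$-marginal of $P\,P_{s|x}$ lies in $\lambda_s$, where $x\sim P$, $s\sim P_{s|x}$, $y=W(x,s)$; and put $C=\max_{P\in\lambda_x}I_{\min}(P)$.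 A code (a set, or an indexed family, of vectors in $\mathcal X^n$) is called $(L-1)$-list decodable if there is no $y\in\mathcal Y^n$ for which $L$ distinct codewords (distinct indices, for a family) can each be turned into $y$ by an admissible noise vector. For a code $\mathcal C\subseteq\mathcal X^n$, the list around $y$ is the set of $x\in\mathcal C$ with $W(x,s)=y$ for some admissible $s\in\mathcal S^n$. Then: 0. The minima and the maximum above are attained. 1. (Random codes) Let $P^*\in\lambda_x$ be any maximizer, $0<\delta\le C$, $R=C-\delta$ and $L=\lceil(1+\log|\mathcal Y|)/\delta\rceil$. There are $\eta,\kappa>0$ and $n_0$ such that for all $n\ge n_0$ and every type $\tau\in\lambda_x$ of a length-$n$ vector with $\|\tau-P^*\|_\infty\le\eta$ (in particular $\tau=P^*$, whenever $P^*$ is such a type), the family of $\lceil2^{nR}\rceil$ codewords drawn independently and uniformly from the vectors of type $\tau$ is $(L-1)$-list decodable with probability at least $1-2^{-n(1-R)}$, and also with probability at least $1-2^{-\kappa n}$. 2. (Achievability) For every $0<\delta\le C$ and all sufficiently large $n\in\mathcal N$ there is a code of admissible inputs of blocklength $n$ with at least $2^{n(C-\delta)}$ codewords that is $(L-1)$-list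 decodable with $L=\lceil(1+\log|\mathcal Y|)/\delta\rceil$; in particular all its lists have size less than $(1+\log|\mathcal Y|)/\delta=O(1/\delta)$. 3. (Converse) For every $\delta>0$ and every $c<1$ there is $n_0$ such that, for every $n\ge n_0$ in $\mathcal N$ and every code $\mathcal C$ of admissible inputs of blocklength $n$ with $|\mathcal C|\ge2^{n(C+\delta)}$, there is $y\in\mathcal Y^n$ around which the list has size at least $2^{cn\delta}$. Thus some list has size $2^{\Omega(n\delta)}$. -/

import Mathlib

open scoped BigOperators Classical

noncomputable section

/-- A (deterministic, state-constrained) adversarial channel with finite input alphabet `X`,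
noise alphabet `S` and output alphabet `Y`: closed convex sets of admissible input and noise
types, and a transition function `W`. -/
structure AdversarialChannel (X S Y : Type*) [Fintype X] [Fintype S] where
  inputSet : Set (X → ℝ)
  inputSet_subset : inputSet ⊆ stdSimplex ℝ X
  inputSet_convex : Convex ℝ inputSet
  inputSet_closed : IsClosed inputSet
  noiseSet : Set (S → ℝ)
  noiseSet_subset : noiseSet ⊆ stdSimplex ℝ S
  noiseSet_convex : Convex ℝ noiseSet
  noiseSet_closed : IsClosed noiseSet
  W : X → S → Y

/-- The type (empirical distribution) of a vector of length `n`. -/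
def vecType {A : Type*} {n : ℕ} (v : Fin n → A) (a : A) : ℝ :=
  ((Finset.univ.filter fun i => v i = a).card : ℝ) / n

/-- The types of vectors whose length `n` lies in `N` are asymptotically dense in the
constraint set `lam`: every point of `lam` is a limit, as `n → ∞` within `N`,
of types of length-`n` vectors which themselves belong to `lam`. -/
def TypesAsymptoticallyDense {A : Type*} [Fintype A] (N : Set ℕ) (lam : Set (A → ℝ)) : Prop :=
  ∀ P ∈ lam, ∀ ε : ℝ, 0 < ε → ∃ n₀ : ℕ, ∀ n ∈ N, n₀ ≤ n →
    ∃ v : Fin n → A, vecType v ∈ lam ∧ dist (vecType v) P < ε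

/-- The mutual information, in bits, of a joint distribution on `X × Y`. -/
def mutualInfo {X Y : Type*} [Fintype X] [Fintype Y] (J : X → Y → ℝ) : ℝ :=
  ∑ x, ∑ y, J x y * Real.logb 2 (J x y / ((∑ y', J x y') * ∑ x', J x' y))

namespace AdversarialChannel

variable {X S Y : Type*} [Fintype X] [Fintype S] [Fintype Y]

/-- The conditional distributions of the noise given the input which, together with the input
distribution `P`, produce an admissible noise distribution. -/
def noiseKernels (A : AdversarialChannel X S Y) (P : X → ℝ) : Set (X → S → ℝ) :=
  {V | (∀ x, V x ∈ stdSimplex ℝ S) ∧ (fun s => ∑ x, P x * V x s) ∈ A.noiseSet}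

/-- The joint distribution of channel input and output. -/
def inputOutput (A : AdversarialChannel X S Y) (P : X → ℝ) (V : X → S → ℝ) (x : X) (y : Y) : ℝ :=
  ∑ s, if A.W x s = y then P x * V x s else 0

/-- The set of values of `I(x; y)` for input distribution `P` as the adversary varies. -/
def infoValues (A : AdversarialChannel X S Y) (P : X → ℝ) : Set ℝ :=
  (fun V => mutualInfo (A.inputOutput P V)) '' A.noiseKernels P

/-- `min I(x; y)` over the admissible adversarial kernels, for input distribution `P`. -/
def minInfo (A : AdversarialChannel X S Y) (P : X → ℝ) : ℝ :=
  sInf (A.infoValues P)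

/-- `max min I(x; y)`. -/
def listCapacity (A : AdversarialChannel X S Y) : ℝ :=
  sSup (A.minInfo '' A.inputSet)

/-- The admissible channel inputs of blocklength `n`. -/
def admissibleInputs (A : AdversarialChannel X S Y) (n : ℕ) : Set (Fin n → X) :=
  {x | vecType x ∈ A.inputSet}

/-- The admissible noise vectors of blocklength `n`. -/
def admissibleNoise (A : AdversarialChannel X S Y) (n : ℕ) : Set (Fin n → S) :=
  {s | vecType s ∈ A.noiseSet}

/-- The letterwise action of the channel on vectors. -/
def transmit (A : AdversarialChannel X S Y) {n : ℕ} (x : Fin n → X) (s : Fin n → S) : Fin n → Y :=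
  fun i => A.W (x i) (s i)

/-- The codewords indexed by `T` are confusable: admissible noise vectors can turn all of them
into one and the same output. -/
def Confusable (A : AdversarialChannel X S Y) {n : ℕ} {ι : Type*}
    (c : ι → Fin n → X) (T : Finset ι) : Prop :=
  ∃ (y : Fin n → Y) (s : ι → Fin n → S),
    ∀ m ∈ T, s m ∈ A.admissibleNoise n ∧ A.transmit (c m) (s m) = y

/-- `(L-1)`-list decodability of the code with codewords `c m`, `m : ι`: no `L` distinct
messages are confusable. A set `C` of vectors is the code `fun m : C => m`. -/
def IsListDecodable (A : AdversarialChannel X S Y) {n : ℕ} {ι : Type*}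
    (c : ι → Fin n → X) (L : ℕ) : Prop :=
  ∀ T : Finset ι, T.card = L → ¬ A.Confusable c T

/-- The list around the output `y`: all codewords which admissible noise can turn into `y`. -/
def outputList (A : AdversarialChannel X S Y) {n : ℕ} (C : Finset (Fin n → X))
    (y : Fin n → Y) : Finset (Fin n → X) :=
  C.filter fun x => ∃ s ∈ A.admissibleNoise n, A.transmit x s = y

/-- The codes with `M` messages all of whose codewords have type `τ`. -/
def compositionCodes (n M : ℕ) (τ : X → ℝ) : Finset (Fin M → Fin n → X) :=
  Finset.univ.filter fun c => ∀ m, vecType (c m) = τ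

/-- The probability that a random code is `(L-1)`-list decodable, when its `M` codewords are
drawn independently and uniformly from the vectors of length `n` and type `τ`
(equivalently, the code is uniform in `compositionCodes n M τ`). -/
def probListDecodable (A : AdversarialChannel X S Y) (n M : ℕ) (τ : X → ℝ) (L : ℕ) : ℝ :=
  (((compositionCodes n M τ).filter fun c => A.IsListDecodable c L).card : ℝ) /
    ((compositionCodes n M τ).card : ℝ)

end AdversarialChannel

end

set_option linter.unusedSectionVars false

/-! ### The method of types -/

/-! The whole argument is counting by types. A type class of entropy `H` has `2 ^ (n * H)` elements
up to a polynomial factor, and there are only polynomially many types. All polynomial factors are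
measured in multiples of `typeError n`, which is o(n).

If `x` and `y` have joint type `z`, then `(typeClass z).card` divided by `(typeClass y).card` is the
number of partners of `y`, and it equals `2 ^ (-n * I)` times the size of the class of `x`, up to
polynomial factors, where `I` is the mutual information of `z`. When admissible noise turns `x` into
`y`, the joint type of input and noise is itself a competitor in the minimum, so `I` is at least
`minInfo`. Hence a random word of the given type reaches a fixed `y` with probability about `2 ^ (-n
* minInfo)` at most (`card_reaching_le`). A union bound over outputs and `L`-subsets of messages
(`one_sub_le_probListDecodable`) has exponent `n * (log |Y| - L * δ)`, at most `-n` by the choice of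
`L`. This gives random codes, and achievability after enlarging the family by a factor `L` and
removing repetitions.

For the converse, pass to the most frequent type in the code. The adversary rounds an optimal joint
distribution to a joint type with a codeword of that type (`exists_vecType_pair_dist_le`). Double
counting pairs of this joint type (`exists_outputList_card_mul_ge`) yields an output whose list has
about `2 ^ (n * (C + δ - I))` elements, with `I` hardly above `C`.

Both halves need stability: `minInfo` is continuous, because a joint distribution can follow a small
change of its input margin while its noise margin stays fixed (`exists_noiseJoints_dist_le`). -/

/-- The number of occurrences of a letter in a vector. -/
noncomputable def letterCount {A : Type*} {n : ℕ} (v : Fin n → A) (a : A) : ℕ :=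
  (Finset.univ.filter fun i => v i = a).card

/-- The push-forward of a function (seen as a measure on a finite set). -/
noncomputable def pushForward {B A : Type*} [Fintype B] (f : B → A) (Q : B → ℝ) (a : A) : ℝ :=
  ∑ b, if f b = a then Q b else 0

/-- The Shannon entropy, in bits. -/
noncomputable def shannonEntropy {A : Type*} [Fintype A] (p : A → ℝ) : ℝ :=
  (∑ a, Real.negMulLog (p a)) / Real.log 2

/-- The vectors of the same type as `v`. -/
noncomputable def typeClass {A : Type*} [Fintype A] {n : ℕ} (v : Fin n → A) :
    Finset (Fin n → A) :=
  Finset.univ.filter fun w => vecType w = vecType v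

/-- The logarithmic error, in bits, of the entropy estimates for blocklength `n`. -/
noncomputable def typeError (n : ℕ) : ℝ := (1 + 2 * Real.log (n + 1)) / Real.log 2

section Types

variable {A B : Type*} {n : ℕ}

lemma vecType_apply (v : Fin n → A) (a : A) : vecType v a = (letterCount v a : ℝ) / n := rfl

lemma letterCount_le (v : Fin n → A) (a : A) : letterCount v a ≤ n := by
  simpa [letterCount] using Finset.card_filter_le (Finset.univ : Finset (Fin n)) fun i => v i = a

lemma vecType_eq_iff (v w : Fin n → A) :
    vecType v = vecType w ↔ ∀ a, letterCount v a = letterCount w a := by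
  constructor
  · intro h a
    have := congrFun h a
    rw [vecType_apply, vecType_apply] at this
    rcases Nat.eq_zero_or_pos n with rfl | hn
    · simp [letterCount]
    · have hn' : (n : ℝ) ≠ 0 := by positivity
      field_simp at this
      exact_mod_cast this
  · intro h
    funext a
    rw [vecType_apply, vecType_apply, h]

lemma letterCount_comp_perm (v : Fin n → A) (σ : Equiv.Perm (Fin n)) (a : A) :
    letterCount (v ∘ σ) a = letterCount v a := by
  unfold letterCount
  refine Finset.card_bij (fun i _ => σ i) (by simp) (by simp) ?_
  intro i hi
  exact ⟨σ.symm i, by simpa using hi, by simp⟩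

lemma vecType_comp_perm (v : Fin n → A) (σ : Equiv.Perm (Fin n)) :
    vecType (v ∘ σ) = vecType v :=
  (vecType_eq_iff _ _).2 (letterCount_comp_perm v σ)

lemma exists_perm_of_vecType_eq {v w : Fin n → A} (h : vecType w = vecType v) :
    ∃ σ : Equiv.Perm (Fin n), w = v ∘ σ := by
  rw [vecType_eq_iff] at h
  have e : ∀ a, Nonempty ({i // w i = a} ≃ {i // v i = a}) := by
    intro a
    rw [← Fintype.card_eq, Fintype.card_subtype, Fintype.card_subtype]
    exact h a
  refine ⟨Equiv.ofFiberEquiv fun a => (e a).some, ?_⟩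
  funext i
  exact (Equiv.ofFiberEquiv_map _ i).symm

lemma letterCount_comp [Fintype B] (f : B → A) (z : Fin n → B) (a : A) :
    letterCount (f ∘ z) a = ∑ b, if f b = a then letterCount z b else 0 := by
  unfold letterCount
  rw [← Finset.sum_filter,
    Finset.card_eq_sum_card_fiberwise (f := z) (t := Finset.univ.filter fun b => f b = a)]
  · refine Finset.sum_congr rfl fun b hb => ?_
    congr 1
    ext i
    simp only [Finset.mem_filter, Finset.mem_univ, true_and, Function.comp] at hb ⊢
    constructor
    · exact fun h => h.2
    · exact fun h => ⟨by rw [h, hb], h⟩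
  · intro i hi
    simpa using hi

lemma vecType_comp [Fintype B] (f : B → A) (z : Fin n → B) :
    vecType (f ∘ z) = pushForward f (vecType z) := by
  funext a
  rw [vecType_apply, letterCount_comp, pushForward]
  push_cast
  rw [Finset.sum_div]
  refine Finset.sum_congr rfl fun b _ => ?_
  split_ifs
  · rfl
  · simp

lemma vecType_nonneg (v : Fin n → A) (a : A) : 0 ≤ vecType v a := by
  rw [vecType_apply]; positivity

variable [Fintype A] [Fintype B]

lemma sum_letterCount (v : Fin n → A) : ∑ a, letterCount v a = n := by
  have := Finset.card_eq_sum_card_fiberwise (f := v) (s := Finset.univ) (t := Finset.univ)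
    (by intro i _; simp)
  simpa [letterCount] using this.symm

lemma mem_typeClass {v w : Fin n → A} : w ∈ typeClass v ↔ vecType w = vecType v := by
  simp [typeClass]

lemma typeClass_card_pos (v : Fin n → A) : 0 < (typeClass v).card :=
  Finset.card_pos.2 ⟨v, mem_typeClass.2 rfl⟩

/-- Orbit-stabilizer: permutations of the coordinates act transitively on the class, and the
stabilizer permutes the positions of each letter separately. -/
lemma typeClass_card_mul (v : Fin n → A) :
    (typeClass v).card * ∏ a, (letterCount v a).factorial = n.factorial := by
  have h := Finset.card_eq_sum_card_fiberwise (f := fun σ : Equiv.Perm (Fin n) => v ∘ σ)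
    (s := Finset.univ) (t := typeClass v)
    (by intro σ _; simpa [mem_typeClass] using vecType_comp_perm v σ)
  rw [Finset.card_univ, Fintype.card_perm, Fintype.card_fin] at h
  rw [h, Finset.sum_const_nat]
  intro w hw
  obtain ⟨τ, rfl⟩ := exists_perm_of_vecType_eq (mem_typeClass.1 hw)
  have hs := DomMulAct.stabilizer_card v
  rw [Fintype.card_subtype] at hs
  have : ∏ a, (letterCount v a).factorial = ∏ a, (Fintype.card {i // v i = a}).factorial := by
    refine Finset.prod_congr rfl fun a _ => ?_
    rw [Fintype.card_subtype]; rfl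
  rw [this, ← hs]
  refine Finset.card_bij (fun σ _ => σ * τ⁻¹) ?_ ?_ ?_
  · intro σ hσ
    simp only [Finset.mem_filter, Finset.mem_univ, true_and] at hσ ⊢
    funext i
    have := congrFun hσ (τ⁻¹ i)
    simpa using this
  · intro σ _ σ' _ h
    simpa using h
  · intro σ hσ
    refine ⟨σ * τ, ?_, by simp⟩
    simp only [Finset.mem_filter, Finset.mem_univ, true_and] at hσ ⊢
    funext i
    exact congrFun hσ (τ i)

lemma mul_log_sub_le_log_factorial (k : ℕ) :
    (k : ℝ) * Real.log k - k ≤ Real.log k.factorial := by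
  rcases Nat.eq_zero_or_pos k with rfl | hk
  · simp
  have h := Real.pow_div_factorial_le_exp (x := (k : ℝ)) (by positivity) k
  have hf : (0 : ℝ) < k.factorial := by exact_mod_cast k.factorial_pos
  have hk' : (0 : ℝ) < k := by exact_mod_cast hk
  have h2 := Real.log_le_log (by positivity) h
  rw [Real.log_exp, Real.log_div (by positivity) (by positivity), Real.log_pow] at h2
  linarith

/-- The induction step loses `1 / (k + 1)`, which is at most `2 / (k + 2)`; this is where the factor
2 before the logarithm is spent. -/
lemma log_factorial_le (k : ℕ) :
    Real.log k.factorial ≤ (k : ℝ) * Real.log k - k + (1 + 2 * Real.log (k + 1)) := by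
  induction k with
  | zero => simp
  | succ k ih =>
    have hf : (0 : ℝ) < k.factorial := by exact_mod_cast k.factorial_pos
    rw [Nat.factorial_succ]
    push_cast
    rw [Real.log_mul (by positivity) (by positivity)]
    have h1 : (k : ℝ) * Real.log k + k / (k + 1) ≤ k * Real.log (k + 1) := by
      rcases Nat.eq_zero_or_pos k with rfl | hk
      · simp
      have hk' : (0 : ℝ) < k := by exact_mod_cast hk
      have := Real.one_sub_inv_le_log_of_pos (x := ((k : ℝ) + 1) / k) (by positivity)
      rw [Real.log_div (by positivity) (by positivity)] at this
      have h3 : 1 - (((k : ℝ) + 1) / k)⁻¹ = 1 / (k + 1) := by field_simp; ring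
      rw [h3] at this
      have h4 := mul_le_mul_of_nonneg_left this hk'.le
      have h5 : (k : ℝ) * (1 / (k + 1)) = k / (k + 1) := by ring
      linarith
    have h2 : 1 / ((k : ℝ) + 1 + 1) ≤ Real.log (k + 1 + 1) - Real.log (k + 1) := by
      have := Real.one_sub_inv_le_log_of_pos (x := ((k : ℝ) + 1 + 1) / (k + 1)) (by positivity)
      rw [Real.log_div (by positivity) (by positivity)] at this
      have h3 : 1 - (((k : ℝ) + 1 + 1) / (k + 1))⁻¹ = 1 / (k + 1 + 1) := by field_simp; ring
      linarith
    have h3 : 1 - (k : ℝ) / (k + 1) ≤ 2 * (1 / ((k : ℝ) + 1 + 1)) := by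
      have : 1 - (k : ℝ) / (k + 1) = 1 / (k + 1) := by field_simp; ring
      rw [this, mul_one_div, div_le_div_iff₀ (by positivity) (by positivity)]
      linarith [(Nat.cast_nonneg k : (0 : ℝ) ≤ k)]
    linarith

lemma mul_shannonEntropy_vecType (v : Fin n → A) :
    n * shannonEntropy (vecType v) * Real.log 2 =
      n * Real.log n - ∑ a, (letterCount v a : ℝ) * Real.log (letterCount v a) := by
  have hl : Real.log 2 ≠ 0 := by positivity
  rcases Nat.eq_zero_or_pos n with rfl | hn
  · simp [letterCount]
  have hn' : (0 : ℝ) < n := by exact_mod_cast hn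
  have hs : (n : ℝ) * Real.log n = ∑ a, (letterCount v a : ℝ) * Real.log n := by
    rw [← Finset.sum_mul, ← Nat.cast_sum, sum_letterCount]
  rw [shannonEntropy, mul_div_assoc', div_mul_cancel₀ _ hl, hs, ← Finset.sum_sub_distrib,
    Finset.mul_sum]
  refine Finset.sum_congr rfl fun a _ => ?_
  rw [vecType_apply, Real.negMulLog]
  rcases Nat.eq_zero_or_pos (letterCount v a) with h | h
  · simp [h]
  · have h' : (0 : ℝ) < letterCount v a := by exact_mod_cast h
    rw [Real.log_div (by positivity) (by positivity)]
    field_simp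
    ring

lemma log_typeClass_card (v : Fin n → A) :
    Real.log (typeClass v).card =
      Real.log n.factorial - ∑ a, Real.log (letterCount v a).factorial := by
  have h := typeClass_card_mul v
  have h' : ((typeClass v).card : ℝ) * ∏ a, ((letterCount v a).factorial : ℝ) = n.factorial := by
    exact_mod_cast h
  have hp : ∀ a, ((letterCount v a).factorial : ℝ) ≠ 0 := fun a => by
    exact_mod_cast (letterCount v a).factorial_ne_zero
  have hc : ((typeClass v).card : ℝ) ≠ 0 := by exact_mod_cast (typeClass_card_pos v).ne'
  rw [← h', Real.log_mul hc (Finset.prod_ne_zero_iff.2 fun a _ => hp a),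
    Real.log_prod fun a _ => hp a]
  ring

lemma sum_letterCount_real (v : Fin n → A) : ∑ a, (letterCount v a : ℝ) = n := by
  rw [← Nat.cast_sum, sum_letterCount]

lemma logb_typeClass_card_le (v : Fin n → A) :
    Real.logb 2 (typeClass v).card ≤ n * shannonEntropy (vecType v) + typeError n := by
  have hl : 0 < Real.log 2 := by positivity
  rw [Real.logb, div_le_iff₀ hl, add_mul, mul_shannonEntropy_vecType, typeError,
    div_mul_cancel₀ _ hl.ne', log_typeClass_card]
  have h1 := log_factorial_le n
  have h2 := Finset.sum_le_sum fun a (_ : a ∈ Finset.univ) =>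
    mul_log_sub_le_log_factorial (letterCount v a)
  rw [Finset.sum_sub_distrib, sum_letterCount_real] at h2
  linarith

lemma le_logb_typeClass_card (v : Fin n → A) :
    n * shannonEntropy (vecType v) - Fintype.card A * typeError n ≤
      Real.logb 2 (typeClass v).card := by
  have hl : 0 < Real.log 2 := by positivity
  rw [Real.logb, le_div_iff₀ hl, sub_mul, mul_shannonEntropy_vecType, typeError, mul_assoc,
    div_mul_cancel₀ _ hl.ne', log_typeClass_card]
  have h1 := mul_log_sub_le_log_factorial n
  have h2 : ∑ a, Real.log (letterCount v a).factorial ≤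
      ∑ a, ((letterCount v a : ℝ) * Real.log (letterCount v a) - letterCount v a +
        (1 + 2 * Real.log (n + 1))) := by
    refine Finset.sum_le_sum fun a _ => (log_factorial_le _).trans ?_
    have : Real.log ((letterCount v a : ℝ) + 1) ≤ Real.log (n + 1) := by
      refine Real.log_le_log (by positivity) ?_
      have : (letterCount v a : ℝ) ≤ n := by exact_mod_cast letterCount_le v a
      linarith
    linarith
  rw [Finset.sum_add_distrib, Finset.sum_sub_distrib, sum_letterCount_real] at h2
  simp only [Finset.sum_const, Finset.card_univ, nsmul_eq_mul] at h2
  linarith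

/-- The vectors of the type of `z` with a prescribed image of the type of `f ∘ z` are equally
numerous for all such images. -/
lemma typeClass_card_comp (f : B → A) (z : Fin n → B) {y : Fin n → A}
    (hy : vecType y = vecType (f ∘ z)) :
    (typeClass z).card =
      (typeClass (f ∘ z)).card * ((typeClass z).filter fun w => f ∘ w = y).card := by
  rw [Finset.card_eq_sum_card_fiberwise (f := fun w => f ∘ w) (t := typeClass (f ∘ z)),
    Finset.sum_const_nat]
  · intro y' hy'
    -- Here `y' = y ∘ σ`, and reordering by `σ⁻¹` carries the fibre over `y'` onto the fibre over
    -- `y`.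
    obtain ⟨σ, hσ⟩ := exists_perm_of_vecType_eq ((mem_typeClass.1 hy').trans hy.symm)
    subst hσ
    refine Finset.card_bij (fun w _ => w ∘ (σ⁻¹ : Equiv.Perm (Fin n))) ?_ ?_ ?_
    · intro w hw
      simp only [Finset.mem_filter, mem_typeClass] at hw ⊢
      refine ⟨by rw [vecType_comp_perm, hw.1], ?_⟩
      funext i
      have := congrFun hw.2 (σ⁻¹ i)
      simpa using this
    · intro w _ w' _ h
      funext i
      have := congrFun h (σ i)
      simpa using this
    · intro w hw
      simp only [Finset.mem_filter, mem_typeClass] at hw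
      refine ⟨w ∘ σ, ?_, ?_⟩
      · simp only [Finset.mem_filter, mem_typeClass]
        exact ⟨by rw [vecType_comp_perm, hw.1], by rw [← hw.2]; rfl⟩
      · funext i; simp
  · intro w hw
    have hw' := mem_typeClass.1 (Finset.mem_coe.1 hw)
    exact Finset.mem_coe.2 (mem_typeClass.2 (by rw [vecType_comp, vecType_comp, hw']))

lemma card_image_vecType_le (s : Finset (Fin n → A)) :
    (s.image vecType).card ≤ (n + 1) ^ Fintype.card A := by
  let g : (Fin n → A) → A → Fin (n + 1) := fun v a => ⟨letterCount v a, by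
    have := letterCount_le v a; omega⟩
  let h : (A → Fin (n + 1)) → A → ℝ := fun k a => ((k a : ℕ) : ℝ) / n
  have : s.image vecType ⊆ (Finset.univ : Finset (A → Fin (n + 1))).image h := by
    intro t ht
    obtain ⟨v, _, rfl⟩ := Finset.mem_image.1 ht
    exact Finset.mem_image.2 ⟨g v, Finset.mem_univ _, rfl⟩
  refine (Finset.card_le_card this).trans (Finset.card_image_le.trans ?_)
  simp

/-- Puts the number of types into the same unit of error as the entropy estimates. -/
lemma natCast_succ_pow_le (n m : ℕ) : (((n + 1) ^ m : ℕ) : ℝ) ≤ 2 ^ ((m : ℝ) * typeError n) := by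
  have hn : (0 : ℝ) < (n : ℝ) + 1 := by positivity
  have h0 : 0 ≤ Real.log ((n : ℝ) + 1) :=
    Real.log_nonneg (by linarith [(Nat.cast_nonneg n : (0 : ℝ) ≤ n)])
  have : (n : ℝ) + 1 ≤ 2 ^ typeError n := by
    rw [← Real.log_le_log_iff hn (by positivity), Real.log_rpow (by norm_num), typeError,
      div_mul_cancel₀ _ (by positivity)]
    linarith
  push_cast
  rw [mul_comm, Real.rpow_mul (by norm_num), Real.rpow_natCast]
  gcongr

/-- Vectors with a prescribed number of occurrences of each letter exist. -/
lemma exists_letterCount_eq (k : A → ℕ) (hk : ∑ a, k a = n) :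
    ∃ v : Fin n → A, ∀ a, letterCount v a = k a := by
  have hc : Fintype.card (Fin n) = Fintype.card (Σ a, Fin (k a)) := by simp [hk]
  let e := Fintype.equivOfCardEq hc
  refine ⟨fun i => (e i).1, fun a => ?_⟩
  unfold letterCount
  rw [← Fintype.card_subtype, Fintype.card_congr ((e.subtypeEquiv
    (q := fun s : Σ a, Fin (k a) => s.1 = a) fun _ => Iff.rfl).trans (Equiv.sigmaSubtype a)),
    Fintype.card_fin]

lemma exists_typeError_le (K ζ : ℝ) (hζ : 0 < ζ) :
    ∃ n₀ : ℕ, ∀ n : ℕ, n₀ ≤ n → K * typeError n ≤ ζ * n := by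
  have h1 : Filter.Tendsto (fun n : ℕ => Real.log ((n : ℝ) + 1) / ((n : ℝ) + 1))
      Filter.atTop (nhds 0) := by
    have h := Real.isLittleO_log_id_atTop.tendsto_div_nhds_zero
    have h2 : Filter.Tendsto (fun n : ℕ => (n : ℝ) + 1) Filter.atTop Filter.atTop :=
      Filter.tendsto_atTop_add_const_right _ _ tendsto_natCast_atTop_atTop
    exact h.comp h2
  have h2 : Filter.Tendsto (fun n : ℕ => 1 / ((n : ℝ) + 1)) Filter.atTop (nhds 0) :=
    tendsto_one_div_add_atTop_nhds_zero_nat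
  have h3 : Filter.Tendsto (fun n : ℕ => K / Real.log 2 * (1 / ((n : ℝ) + 1) +
      2 * (Real.log ((n : ℝ) + 1) / ((n : ℝ) + 1)))) Filter.atTop (nhds 0) := by
    simpa using (h2.add (h1.const_mul 2)).const_mul (K / Real.log 2)
  have h4 := h3.eventually (gt_mem_nhds (half_pos hζ))
  obtain ⟨n₀, hn₀⟩ := Filter.eventually_atTop.1 h4
  refine ⟨max n₀ 1, fun n hn => ?_⟩
  have h5 := hn₀ n (le_of_max_le_left hn)
  have hn1 : (1 : ℝ) ≤ n := by exact_mod_cast le_of_max_le_right hn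
  have h6 : K * typeError n = K / Real.log 2 * (1 / ((n : ℝ) + 1) +
      2 * (Real.log ((n : ℝ) + 1) / ((n : ℝ) + 1))) * (n + 1) := by
    unfold typeError; field_simp
  rw [h6]
  nlinarith

end Types

/-! ### Information quantities as functions of the joint distribution of input and noise -/

section PushForward

variable {A B C : Type*} [Fintype A] [Fintype B] [Fintype C]

lemma pushForward_nonneg {f : B → A} {Q : B → ℝ} (hQ : ∀ b, 0 ≤ Q b) (a : A) :
    0 ≤ pushForward f Q a :=
  Finset.sum_nonneg fun b _ => by split_ifs <;> simp [hQ b]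

lemma sum_pushForward (f : B → A) (Q : B → ℝ) : ∑ a, pushForward f Q a = ∑ b, Q b := by
  unfold pushForward
  rw [Finset.sum_comm]
  simp

lemma pushForward_pushForward (g : A → C) (f : B → A) (Q : B → ℝ) :
    pushForward g (pushForward f Q) = pushForward (g ∘ f) Q := by
  funext c
  unfold pushForward
  have : ∀ a, (if g a = c then ∑ b, (if f b = a then Q b else 0) else 0) =
      ∑ b, if f b = a then (if g a = c then Q b else 0) else 0 := by
    intro a
    split_ifs <;> simp
  simp_rw [this]
  rw [Finset.sum_comm]
  refine Finset.sum_congr rfl fun b _ => ?_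
  simp

lemma pushForward_fst (Q : A × B → ℝ) (a : A) : pushForward Prod.fst Q a = ∑ b, Q (a, b) := by
  unfold pushForward
  rw [Fintype.sum_prod_type, Finset.sum_eq_single a]
  · simp
  · intro a' _ h; simp [h]
  · simp

lemma pushForward_snd (Q : A × B → ℝ) (b : B) : pushForward Prod.snd Q b = ∑ a, Q (a, b) := by
  unfold pushForward
  rw [Fintype.sum_prod_type_right, Finset.sum_eq_single b]
  · simp
  · intro a' _ h; simp [h]
  · simp

lemma continuous_pushForward (f : B → A) : Continuous (pushForward f) := by
  refine continuous_pi fun a => ?_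
  unfold pushForward
  refine continuous_finsetSum _ fun b _ => ?_
  split_ifs <;> fun_prop

lemma continuous_shannonEntropy : Continuous (shannonEntropy : (A → ℝ) → ℝ) := by
  unfold shannonEntropy
  refine Continuous.div_const (continuous_finsetSum _ fun a _ => ?_) _
  exact Real.continuous_negMulLog.comp (continuous_apply a)

/-- An atom never weighs more than the fibre containing it, so its `-log` can only decrease; no
normalization is needed. -/
lemma shannonEntropy_pushForward_le (f : B → A) {Q : B → ℝ} (hQ : ∀ b, 0 ≤ Q b) :
    shannonEntropy (pushForward f Q) ≤ shannonEntropy Q := by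
  unfold shannonEntropy
  refine div_le_div_of_nonneg_right ?_ (by positivity)
  have h1 : ∑ a, Real.negMulLog (pushForward f Q a) =
      ∑ b, -(Q b) * Real.log (pushForward f Q (f b)) := by
    have : ∀ a, Real.negMulLog (pushForward f Q a) =
        ∑ b, if f b = a then -(Q b) * Real.log (pushForward f Q a) else 0 := by
      intro a
      rw [Real.negMulLog]
      change -(∑ b, if f b = a then Q b else 0) * Real.log (pushForward f Q a) = _
      rw [← Finset.sum_neg_distrib, Finset.sum_mul]
      refine Finset.sum_congr rfl fun b _ => ?_
      split_ifs <;> simp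
    simp_rw [this]
    rw [Finset.sum_comm]
    simp
  rw [h1]
  refine Finset.sum_le_sum fun b _ => ?_
  rw [Real.negMulLog]
  rcases (hQ b).eq_or_lt with h | h
  · simp [← h]
  have hle : Q b ≤ pushForward f Q (f b) := by
    have := Finset.single_le_sum (f := fun b' => if f b' = f b then Q b' else 0)
      (fun b' _ => by split_ifs <;> simp [hQ b']) (Finset.mem_univ b)
    simpa [pushForward] using this
  have := Real.log_le_log h hle
  nlinarith

lemma shannonEntropy_le {p : A → ℝ} (hp : p ∈ stdSimplex ℝ A) :
    shannonEntropy p ≤ Real.logb 2 (Fintype.card A) := by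
  unfold shannonEntropy Real.logb
  refine div_le_div_of_nonneg_right ?_ (by positivity)
  have hne : Nonempty A := by
    by_contra h
    rw [not_nonempty_iff] at h
    simpa using hp.2
  have hc : (0 : ℝ) < Fintype.card A := by exact_mod_cast Fintype.card_pos
  -- From `log t ≥ 1 - 1 / t` at `t = p a * |A|`; the correction terms in brackets sum to zero.
  have h : ∀ a, Real.negMulLog (p a) ≤
      p a * Real.log (Fintype.card A) + (1 / Fintype.card A - p a) := by
    intro a
    rcases (hp.1 a).eq_or_lt with h | h
    · simp [← h]
    have := Real.one_sub_inv_le_log_of_pos (mul_pos h hc)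
    rw [Real.log_mul h.ne' hc.ne'] at this
    have h2 := mul_le_mul_of_nonneg_left this h.le
    have h3 : p a * (1 - (p a * Fintype.card A)⁻¹) = p a - 1 / Fintype.card A := by field_simp
    rw [Real.negMulLog]
    linarith
  refine (Finset.sum_le_sum fun a _ => h a).trans ?_
  rw [Finset.sum_add_distrib, ← Finset.sum_mul, Finset.sum_sub_distrib, hp.2]
  simp only [Finset.sum_const, Finset.card_univ, nsmul_eq_mul]
  rw [mul_one_div, div_self hc.ne']
  linarith

lemma mutualInfo_eq {J : A → B → ℝ} (hJ : ∀ a b, 0 ≤ J a b) :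
    mutualInfo J = shannonEntropy (fun a => ∑ b, J a b) + shannonEntropy (fun b => ∑ a, J a b) -
      shannonEntropy (fun p : A × B => J p.1 p.2) := by
  have h : ∀ a b, J a b * Real.logb 2 (J a b / ((∑ b', J a b') * ∑ a', J a' b)) =
      (-(J a b * Real.log (∑ b', J a b')) - J a b * Real.log (∑ a', J a' b) -
        Real.negMulLog (J a b)) / Real.log 2 := by
    intro a b
    rcases (hJ a b).eq_or_lt with h | h
    · simp [← h]
    have h1 : J a b ≤ ∑ b', J a b' :=
      Finset.single_le_sum (f := fun b' => J a b') (fun b' _ => hJ a b') (Finset.mem_univ b)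
    have h2 : J a b ≤ ∑ a', J a' b :=
      Finset.single_le_sum (f := fun a' => J a' b) (fun a' _ => hJ a' b) (Finset.mem_univ a)
    have h1' := h.trans_le h1
    have h2' := h.trans_le h2
    rw [Real.logb, Real.log_div h.ne' (mul_pos h1' h2').ne', Real.log_mul h1'.ne' h2'.ne',
      Real.negMulLog]
    ring
  unfold mutualInfo shannonEntropy
  simp_rw [h, ← Finset.sum_div, Finset.sum_sub_distrib, Finset.sum_neg_distrib]
  rw [Fintype.sum_prod_type, Finset.sum_comm (f := fun a b => J a b * Real.log (∑ a', J a' b))]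
  simp_rw [Real.negMulLog, ← Finset.sum_mul, neg_mul, Finset.sum_neg_distrib]
  ring

end PushForward

/-- Truncation at zero costs nothing here: a single entry above `ρ` already pays the full `ρ`. This
makes room under a margin that has been lowered by at most `ρ`. -/
lemma sum_max_sub_le {ι : Type*} [Fintype ι] {a : ι → ℝ} (ha : ∀ i, 0 ≤ a i) {ρ : ℝ} (hρ : 0 ≤ ρ) :
    ∑ i, max (a i - ρ) 0 ≤ max ((∑ i, a i) - ρ) 0 := by
  by_cases h : ∃ i, ρ < a i
  · obtain ⟨i, hi⟩ := h
    refine le_max_of_le_left ?_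
    rw [← Finset.add_sum_erase _ _ (Finset.mem_univ i), ← Finset.add_sum_erase _ a
      (Finset.mem_univ i), max_eq_left (by linarith)]
    have : ∑ j ∈ Finset.univ.erase i, max (a j - ρ) 0 ≤ ∑ j ∈ Finset.univ.erase i, a j :=
      Finset.sum_le_sum fun j _ => max_le (by linarith) (ha j)
    linarith
  · push Not at h
    refine le_max_of_le_right (le_of_eq (Finset.sum_eq_zero fun i _ => ?_))
    exact max_eq_right (by linarith [h i])

/-! ### Attainment and continuity of the minimal information -/

namespace AdversarialChannel

variable {X S Y : Type*} [Fintype X] [Fintype S] [Fintype Y]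

/-- The channel output as a function of the pair of input and noise. -/
def outMap (A : AdversarialChannel X S Y) (p : X × S) : Y := A.W p.1 p.2

/-- The pair of input and output as a function of the pair of input and noise. -/
def inOutMap (A : AdversarialChannel X S Y) (p : X × S) : X × Y := (p.1, A.W p.1 p.2)

/-- The mutual information of input and output, for a joint distribution of input and noise. -/
noncomputable def jointInfo (A : AdversarialChannel X S Y) (Q : X × S → ℝ) : ℝ :=
  shannonEntropy (pushForward Prod.fst Q) + shannonEntropy (pushForward A.outMap Q) -
    shannonEntropy (pushForward A.inOutMap Q)

/-- The joint distributions of input and noise with input distribution `P` and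
admissible noise distribution. -/
def noiseJoints (A : AdversarialChannel X S Y) (P : X → ℝ) : Set (X × S → ℝ) :=
  {Q | (∀ p, 0 ≤ Q p) ∧ pushForward Prod.fst Q = P ∧ pushForward Prod.snd Q ∈ A.noiseSet}

lemma continuous_jointInfo (A : AdversarialChannel X S Y) : Continuous A.jointInfo :=
  ((continuous_shannonEntropy.comp (continuous_pushForward _)).add
    (continuous_shannonEntropy.comp (continuous_pushForward _))).sub
    (continuous_shannonEntropy.comp (continuous_pushForward _))

lemma mutualInfo_inputOutput (A : AdversarialChannel X S Y) {P : X → ℝ} {V : X → S → ℝ}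
    (h : ∀ x s, 0 ≤ P x * V x s) :
    mutualInfo (A.inputOutput P V) = A.jointInfo fun p : X × S => P p.1 * V p.1 p.2 := by
  set Q : X × S → ℝ := fun p => P p.1 * V p.1 p.2 with hQ
  have hJ : ∀ x y, A.inputOutput P V x y = pushForward A.inOutMap Q (x, y) := by
    intro x y
    unfold inputOutput pushForward
    rw [Fintype.sum_prod_type, Finset.sum_eq_single x]
    · simp [inOutMap, hQ]
    · intro x' _ hx
      simp [inOutMap, hx]
    · simp
  have h0 : ∀ x y, 0 ≤ A.inputOutput P V x y := by
    intro x y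
    rw [hJ]
    exact pushForward_nonneg (fun p : X × S => h p.1 p.2) _
  rw [mutualInfo_eq h0]
  simp only [hJ]
  rw [jointInfo]
  congr 3
  · funext x
    rw [← pushForward_fst, pushForward_pushForward]
    rfl
  · funext y
    rw [← pushForward_snd, pushForward_pushForward]
    rfl

/-- Joint distributions replace kernels because the constraints on them are linear and closed, and
the information is continuous in them. -/
lemma infoValues_eq (A : AdversarialChannel X S Y) (hS : A.noiseSet.Nonempty) {P : X → ℝ}
    (hP : ∀ x, 0 ≤ P x) : A.infoValues P = A.jointInfo '' A.noiseJoints P := by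
  obtain ⟨q, hq⟩ := hS
  have hq' := A.noiseSet_subset hq
  ext t
  constructor
  · rintro ⟨V, hV, rfl⟩
    refine ⟨fun p : X × S => P p.1 * V p.1 p.2, ⟨fun p => mul_nonneg (hP _) ((hV.1 _).1 _), ?_, ?_⟩, ?_⟩
    · funext x
      rw [pushForward_fst]
      simp only
      rw [← Finset.mul_sum, (hV.1 x).2, mul_one]
    · convert hV.2 using 1
      funext s
      rw [pushForward_snd]
    · exact (A.mutualInfo_inputOutput (P := P) (V := V) fun x s => mul_nonneg (hP _) ((hV.1 _).1 _)).symm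
  · rintro ⟨Q, ⟨h0, h1, h2⟩, rfl⟩
    have hsum : ∀ x, ∑ s, Q (x, s) = P x := fun x => by rw [← pushForward_fst, h1]
    -- Where `P` vanishes the kernel has no effect; `q` merely supplies a probability vector.
    let V : X → S → ℝ := fun x s => if P x = 0 then q s else Q (x, s) / P x
    have hPV : ∀ x s, P x * V x s = Q (x, s) := by
      intro x s
      by_cases hx : P x = 0
      · have := (Finset.sum_eq_zero_iff_of_nonneg fun s _ => h0 (x, s)).1 ((hsum x).trans hx) s
          (Finset.mem_univ s)
        simp [hx, this]
      · simp only [V, hx, if_false]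
        field_simp
    have hQ : (fun p : X × S => P p.1 * V p.1 p.2) = Q := by
      funext p
      exact hPV p.1 p.2
    refine ⟨V, ⟨fun x => ?_, ?_⟩, ?_⟩
    · by_cases hx : P x = 0
      · have : V x = q := by funext s; simp [V, hx]
        rw [this]; exact hq'
      · refine ⟨fun s => ?_, ?_⟩
        · simp only [V, hx, if_false]
          exact div_nonneg (h0 _) (hP x)
        · simp only [V, hx, if_false]
          rw [← Finset.sum_div, hsum, div_self hx]
    · convert h2 using 1
      funext s
      rw [pushForward_snd]
      exact Finset.sum_congr rfl fun x _ => hPV x s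
    · simp only
      rw [A.mutualInfo_inputOutput fun x s => by rw [hPV]; exact h0 _, hQ]

lemma noiseJoints_nonempty (A : AdversarialChannel X S Y) (hS : A.noiseSet.Nonempty) {P : X → ℝ}
    (hP : P ∈ stdSimplex ℝ X) : (A.noiseJoints P).Nonempty := by
  obtain ⟨q, hq⟩ := hS
  have hq' := A.noiseSet_subset hq
  refine ⟨fun p : X × S => P p.1 * q p.2, fun p => mul_nonneg (hP.1 _) (hq'.1 _), ?_, ?_⟩
  · funext x
    rw [pushForward_fst]
    simp only
    rw [← Finset.mul_sum, hq'.2, mul_one]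
  · convert hq using 1
    funext s
    rw [pushForward_snd]
    simp only
    rw [← Finset.sum_mul, hP.2, one_mul]

lemma noiseJoints_subset_Icc (A : AdversarialChannel X S Y) {P : X → ℝ}
    (hP : P ∈ stdSimplex ℝ X) : A.noiseJoints P ⊆ Set.Icc 0 1 := by
  rintro Q ⟨h0, h1, -⟩
  refine ⟨fun p => h0 p, fun p => ?_⟩
  have hsum : ∑ s, Q (p.1, s) = P p.1 := by rw [← pushForward_fst, h1]
  have h2 : Q (p.1, p.2) ≤ ∑ s, Q (p.1, s) :=
    Finset.single_le_sum (f := fun s => Q (p.1, s)) (fun s _ => h0 _) (Finset.mem_univ p.2)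
  have h3 : P p.1 ≤ ∑ x, P x := Finset.single_le_sum (fun x _ => hP.1 x) (Finset.mem_univ p.1)
  rw [hP.2] at h3
  simp only [Pi.one_apply]
  linarith

lemma isCompact_noiseJoints (A : AdversarialChannel X S Y) {P : X → ℝ}
    (hP : P ∈ stdSimplex ℝ X) : IsCompact (A.noiseJoints P) := by
  refine isCompact_Icc.of_isClosed_subset ?_ (A.noiseJoints_subset_Icc hP)
  have h1 : IsClosed {Q : X × S → ℝ | ∀ p, 0 ≤ Q p} := by
    simp only [Set.ofPred_forall]
    exact isClosed_iInter fun p => isClosed_le continuous_const (continuous_apply p)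
  have h2 : IsClosed {Q : X × S → ℝ | pushForward Prod.fst Q = P} :=
    isClosed_eq (continuous_pushForward _) continuous_const
  exact h1.inter (h2.inter (A.noiseSet_closed.preimage (continuous_pushForward _)))

lemma isLeast_minInfo (A : AdversarialChannel X S Y) (hS : A.noiseSet.Nonempty) {P : X → ℝ}
    (hP : P ∈ stdSimplex ℝ X) : IsLeast (A.infoValues P) (A.minInfo P) := by
  rw [minInfo, A.infoValues_eq hS hP.1]
  exact ((A.isCompact_noiseJoints hP).image A.continuous_jointInfo).isLeast_sInf
    ((A.noiseJoints_nonempty hS hP).image _)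

lemma minInfo_le_jointInfo (A : AdversarialChannel X S Y) (hS : A.noiseSet.Nonempty) {P : X → ℝ}
    (hP : P ∈ stdSimplex ℝ X) {Q : X × S → ℝ} (hQ : Q ∈ A.noiseJoints P) :
    A.minInfo P ≤ A.jointInfo Q := by
  refine (A.isLeast_minInfo hS hP).2 ?_
  rw [A.infoValues_eq hS hP.1]
  exact ⟨Q, hQ, rfl⟩

lemma exists_jointInfo_eq_minInfo (A : AdversarialChannel X S Y) (hS : A.noiseSet.Nonempty)
    {P : X → ℝ} (hP : P ∈ stdSimplex ℝ X) :
    ∃ Q ∈ A.noiseJoints P, A.jointInfo Q = A.minInfo P := by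
  have := (A.isLeast_minInfo hS hP).1
  rwa [A.infoValues_eq hS hP.1] at this

lemma jointInfo_uniform (A : AdversarialChannel X S Y) {ε : ℝ} (hε : 0 < ε) :
    ∃ r : ℝ, 0 < r ∧ ∀ Q ∈ Set.Icc (0 : X × S → ℝ) 1, ∀ Q' ∈ Set.Icc (0 : X × S → ℝ) 1,
      dist Q Q' < r → dist (A.jointInfo Q) (A.jointInfo Q') < ε := by
  have := (isCompact_Icc (a := (0 : X × S → ℝ)) (b := 1)).uniformContinuousOn_of_continuous
    A.continuous_jointInfo.continuousOn
  rw [Metric.uniformContinuousOn_iff] at this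
  exact this ε hε

/-- A joint distribution can be moved to a nearby input distribution without
changing the noise distribution. -/
lemma exists_noiseJoints_dist_le (A : AdversarialChannel X S Y) {P P' : X → ℝ}
    (hP : P ∈ stdSimplex ℝ X) (hP' : P' ∈ stdSimplex ℝ X) {Q : X × S → ℝ}
    (hQ : Q ∈ A.noiseJoints P) :
    ∃ Q' ∈ A.noiseJoints P', dist Q Q' ≤ (Fintype.card S + 1) * dist P P' := by
  obtain ⟨h0, h1, h2⟩ := hQ
  set ρ := dist P P' with hρ
  have hρ0 : 0 ≤ ρ := dist_nonneg
  have hd : ∀ x, |P x - P' x| ≤ ρ := fun x => by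
    rw [← Real.dist_eq]; exact dist_le_pi_dist P P' x
  have hsum : ∀ x, ∑ s, Q (x, s) = P x := fun x => by rw [← pushForward_fst, h1]
  -- Shave `ρ` off every entry. The remainder fits under both the new input margin and the old noise
  -- margin; `r` and `c` are the deficits, of equal total `t`, to be filled by the product `r * c /
  -- t`.
  set K : X × S → ℝ := fun p => max (Q p - ρ) 0 with hK
  have hK0 : ∀ p, 0 ≤ K p := fun p => le_max_right _ _
  have hKQ : ∀ p, K p ≤ Q p := fun p => max_le (by linarith) (h0 p)
  have hQK : ∀ p, Q p - ρ ≤ K p := fun p => le_max_left _ _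
  set r : X → ℝ := fun x => P' x - ∑ s, K (x, s) with hr
  set c : S → ℝ := fun s => pushForward Prod.snd Q s - ∑ x, K (x, s) with hc
  have hr0 : ∀ x, 0 ≤ r x := by
    intro x
    have := sum_max_sub_le (a := fun s => Q (x, s)) (fun s => h0 _) hρ0
    rw [hsum] at this
    have h3 : max (P x - ρ) 0 ≤ P' x := max_le (by linarith [(abs_le.1 (hd x)).2]) (hP'.1 x)
    simp only [hr, hK]
    linarith
  have hc0 : ∀ s, 0 ≤ c s := by
    intro s
    simp only [hc, pushForward_snd]
    linarith [Finset.sum_le_sum fun x (_ : x ∈ Finset.univ) => hKQ (x, s)]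
  have hrle : ∀ x, r x ≤ (Fintype.card S + 1) * ρ := by
    intro x
    have h3 := Finset.sum_le_sum fun s (_ : s ∈ Finset.univ) => hQK (x, s)
    rw [Finset.sum_sub_distrib, hsum] at h3
    simp only [Finset.sum_const, Finset.card_univ, nsmul_eq_mul] at h3
    simp only [hr]
    linarith [(abs_le.1 (hd x)).1]
  set t := ∑ x, r x with ht
  have htc : ∑ s, c s = t := by
    simp only [ht, hr, hc, Finset.sum_sub_distrib, sum_pushForward]
    rw [hP'.2, Fintype.sum_prod_type, Finset.sum_comm (f := fun s x => K (x, s))]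
    simp only [hsum, hP.2]
  have ht0 : 0 ≤ t := Finset.sum_nonneg fun x _ => hr0 x
  -- For `t = 0` all deficits vanish, and division by zero returns the right value.
  have hrt : ∀ x, r x * t / t = r x := by
    intro x
    by_cases h : t = 0
    · have := (Finset.sum_eq_zero_iff_of_nonneg fun x _ => hr0 x).1 h x (Finset.mem_univ x)
      rw [this]; simp
    · field_simp
  have hct : ∀ s, t * c s / t = c s := by
    intro s
    by_cases h : t = 0
    · have := (Finset.sum_eq_zero_iff_of_nonneg fun s _ => hc0 s).1 (htc.trans h) s
        (Finset.mem_univ s)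
      rw [this]; simp
    · field_simp
  have hF0 : ∀ x s, 0 ≤ r x * c s / t := fun x s => div_nonneg (mul_nonneg (hr0 x) (hc0 s)) ht0
  have hF : ∀ x s, r x * c s / t ≤ r x := by
    intro x s
    have hcs : c s ≤ t := by
      rw [← htc]; exact Finset.single_le_sum (fun s _ => hc0 s) (Finset.mem_univ s)
    calc r x * c s / t ≤ r x * t / t :=
          div_le_div_of_nonneg_right (mul_le_mul_of_nonneg_left hcs (hr0 x)) ht0
      _ = r x := hrt x
  refine ⟨fun p => K p + r p.1 * c p.2 / t, ⟨fun p => add_nonneg (hK0 p) (hF0 _ _), ?_, ?_⟩, ?_⟩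
  · funext x
    rw [pushForward_fst]
    simp only
    rw [Finset.sum_add_distrib, ← Finset.sum_div, ← Finset.mul_sum, htc, hrt]
    simp only [hr]
    ring
  · convert h2 using 1
    funext s
    rw [pushForward_snd]
    simp only
    rw [Finset.sum_add_distrib, ← Finset.sum_div, ← Finset.sum_mul, ← ht, hct]
    simp only [hc]
    ring
  · rw [dist_pi_le_iff (by positivity)]
    intro p
    rw [Real.dist_eq, abs_le]
    have a1 := hF p.1 p.2
    have a2 := hF0 p.1 p.2
    have a3 := hrle p.1
    have a4 := hKQ p
    have a5 := hQK p
    have a6 : 0 ≤ (Fintype.card S : ℝ) * ρ := by positivity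
    constructor <;> linarith

/-- An optimal joint distribution for `P`, moved to `P'`, is a competitor there. Exchanging the two
gives the other inequality. -/
lemma minInfo_uniform (A : AdversarialChannel X S Y) (hS : A.noiseSet.Nonempty) {ε : ℝ}
    (hε : 0 < ε) :
    ∃ η : ℝ, 0 < η ∧ ∀ P ∈ stdSimplex ℝ X, ∀ P' ∈ stdSimplex ℝ X, dist P P' ≤ η →
      A.minInfo P' ≤ A.minInfo P + ε := by
  obtain ⟨r, hr, h⟩ := A.jointInfo_uniform hε
  have hc : (0 : ℝ) < Fintype.card S + 1 := by positivity
  refine ⟨r / 2 / (Fintype.card S + 1), by positivity, fun P hP P' hP' hd => ?_⟩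
  obtain ⟨Q, hQ, hQe⟩ := A.exists_jointInfo_eq_minInfo hS hP
  obtain ⟨Q', hQ', hQd⟩ := A.exists_noiseJoints_dist_le hP hP' hQ
  have h1 : dist Q Q' < r := by
    rw [le_div_iff₀ hc] at hd
    linarith
  have h2 := h Q (A.noiseJoints_subset_Icc hP hQ) Q' (A.noiseJoints_subset_Icc hP' hQ') h1
  rw [Real.dist_eq] at h2
  have h3 := A.minInfo_le_jointInfo hS hP' hQ'
  linarith [(abs_lt.1 h2).1]

lemma isGreatest_listCapacity (A : AdversarialChannel X S Y) (hX : A.inputSet.Nonempty)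
    (hS : A.noiseSet.Nonempty) : IsGreatest (A.minInfo '' A.inputSet) A.listCapacity := by
  have hc : IsCompact A.inputSet :=
    (isCompact_stdSimplex ℝ X).of_isClosed_subset A.inputSet_closed A.inputSet_subset
  have hcont : ContinuousOn A.minInfo A.inputSet := by
    rw [Metric.continuousOn_iff]
    intro P hP ε hε
    obtain ⟨η, hη, h⟩ := A.minInfo_uniform hS (half_pos hε)
    refine ⟨η, hη, fun P' hP' hd => ?_⟩
    have h1 := h P' (A.inputSet_subset hP') P (A.inputSet_subset hP) hd.le
    have h2 := h P (A.inputSet_subset hP) P' (A.inputSet_subset hP') (by rw [dist_comm]; exact hd.le)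
    rw [Real.dist_eq, abs_lt]
    constructor <;> linarith
  exact (hc.image_of_continuousOn hcont).isGreatest_sSup (hX.image _)

lemma minInfo_le_listCapacity (A : AdversarialChannel X S Y) (hS : A.noiseSet.Nonempty)
    {P : X → ℝ} (hP : P ∈ A.inputSet) : A.minInfo P ≤ A.listCapacity :=
  (A.isGreatest_listCapacity ⟨P, hP⟩ hS).2 ⟨P, hP, rfl⟩

/-- Since `H(x) ≤ H(x, y)`, the information is at most `H(y)`. The bound ensures that the list
parameter exceeds 1 even for `δ = C`. -/
lemma listCapacity_le (A : AdversarialChannel X S Y) (hX : A.inputSet.Nonempty)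
    (hS : A.noiseSet.Nonempty) : A.listCapacity ≤ Real.logb 2 (Fintype.card Y) := by
  obtain ⟨P, hP, hPe⟩ := (A.isGreatest_listCapacity hX hS).1
  have hP' := A.inputSet_subset hP
  obtain ⟨Q, hQ, hQe⟩ := A.exists_jointInfo_eq_minInfo hS hP'
  rw [← hPe, ← hQe, jointInfo]
  have h1 : shannonEntropy (pushForward Prod.fst Q) ≤
      shannonEntropy (pushForward A.inOutMap Q) := by
    have : pushForward Prod.fst Q = pushForward Prod.fst (pushForward A.inOutMap Q) := by
      rw [pushForward_pushForward]; rfl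
    rw [this]
    exact shannonEntropy_pushForward_le _ (pushForward_nonneg hQ.1)
  have h2 : shannonEntropy (pushForward A.outMap Q) ≤ Real.logb 2 (Fintype.card Y) := by
    refine shannonEntropy_le ⟨pushForward_nonneg hQ.1, ?_⟩
    rw [sum_pushForward, ← sum_pushForward Prod.fst, hQ.2.1, hP'.2]
  linarith

end AdversarialChannel

/-! ### Random constant-composition codes -/

lemma typeClass_card_le_rpow {A : Type*} [Fintype A] {n : ℕ} (v : Fin n → A) :
    ((typeClass v).card : ℝ) ≤ 2 ^ (n * shannonEntropy (vecType v) + typeError n) := by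
  have h : (0 : ℝ) < (typeClass v).card := by exact_mod_cast typeClass_card_pos v
  exact (Real.logb_le_iff_le_rpow (by norm_num) h).1 (logb_typeClass_card_le v)

lemma rpow_le_typeClass_card {A : Type*} [Fintype A] {n : ℕ} (v : Fin n → A) :
    2 ^ (n * shannonEntropy (vecType v) - Fintype.card A * typeError n) ≤
      ((typeClass v).card : ℝ) := by
  have h : (0 : ℝ) < (typeClass v).card := by exact_mod_cast typeClass_card_pos v
  exact (Real.le_logb_iff_rpow_le (by norm_num) h).1 (le_logb_typeClass_card v)

namespace AdversarialChannel

variable {X S Y : Type*} [Fintype X] [Fintype S] [Fintype Y]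

lemma jointInfo_vecType (A : AdversarialChannel X S Y) {n : ℕ} (x : Fin n → X) (s : Fin n → S) :
    A.jointInfo (vecType fun i => (x i, s i)) =
      shannonEntropy (vecType x) + shannonEntropy (vecType (A.transmit x s)) -
        shannonEntropy (vecType fun i => (x i, A.transmit x s i)) := by
  rw [jointInfo, ← vecType_comp, ← vecType_comp, ← vecType_comp]
  rfl

lemma vecType_pair_mem_noiseJoints (A : AdversarialChannel X S Y) {n : ℕ} (x : Fin n → X)
    {s : Fin n → S} (hs : s ∈ A.admissibleNoise n) :
    (vecType fun i => (x i, s i)) ∈ A.noiseJoints (vecType x) := by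
  refine ⟨vecType_nonneg _, ?_, ?_⟩
  · rw [← vecType_comp]; rfl
  · rw [← vecType_comp]; exact hs

/-- The vectors of the type of `v` which admissible noise can turn into `y`. -/
noncomputable def reaching (A : AdversarialChannel X S Y) {n : ℕ} (v : Fin n → X) (y : Fin n → Y) :
    Finset (Fin n → X) :=
  (typeClass v).filter fun x => ∃ s ∈ A.admissibleNoise n, A.transmit x s = y

/-- Sort the words by their joint type with `y`. Each joint type `z` that occurs accounts for at
most `(typeClass z).card / (typeClass y).card` words, and comes from a joint type of input and noise
that competes in `minInfo`. -/
lemma card_reaching_le (A : AdversarialChannel X S Y) (hS : A.noiseSet.Nonempty) {n : ℕ}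
    (v : Fin n → X) (hv : vecType v ∈ A.inputSet) (y : Fin n → Y) :
    ((A.reaching v y).card : ℝ) ≤
      2 ^ (-(n * A.minInfo (vecType v)) +
        (Fintype.card (X × Y) + (1 + Fintype.card Y + Fintype.card X)) * typeError n) *
        (typeClass v).card := by
  set e := typeError n with he
  set D : ℝ := 2 ^ (-(n * A.minInfo (vecType v)) + (1 + Fintype.card Y + Fintype.card X) * e) *
    (typeClass v).card with hD
  have key : ∀ x ∈ A.reaching v y, (((A.reaching v y).filter fun x' =>
      (vecType fun i => (x' i, y i)) = vecType fun i => (x i, y i)).card : ℝ) ≤ D := by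
    intro x hx
    obtain ⟨hxv, s, hs, hy⟩ := Finset.mem_filter.1 hx
    have hxv := mem_typeClass.1 hxv
    set z : Fin n → X × Y := fun i => (x i, y i) with hz
    have hcomp := typeClass_card_comp Prod.snd z (y := y) rfl
    have hzy : Prod.snd ∘ z = y := rfl
    rw [hzy] at hcomp
    have hle : ((A.reaching v y).filter fun x' =>
        (vecType fun i => (x' i, y i)) = vecType z).card ≤
        ((typeClass z).filter fun w => Prod.snd ∘ w = y).card := by
      refine Finset.card_le_card_of_injOn (fun x' i => (x' i, y i)) ?_ ?_
      · intro x' hx'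
        simp only [Finset.coe_filter, Set.mem_ofPred_eq] at hx'
        simp only [Finset.coe_filter, Set.mem_ofPred_eq, mem_typeClass]
        exact ⟨hx'.2, rfl⟩
      · intro x' _ x'' _ h
        funext i
        exact congrArg Prod.fst (congrFun h i)
    refine (Nat.cast_le.2 hle).trans ?_
    have hI := A.minInfo_le_jointInfo hS (A.inputSet_subset hv)
      (hxv ▸ A.vecType_pair_mem_noiseJoints x hs)
    rw [A.jointInfo_vecType, hy, hxv] at hI
    have h1 := typeClass_card_le_rpow z
    have h2 := rpow_le_typeClass_card y
    have h3 := rpow_le_typeClass_card v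
    have hcomp' : ((typeClass z).card : ℝ) = (typeClass y).card *
      ((typeClass z).filter fun w => Prod.snd ∘ w = y).card := by exact_mod_cast hcomp
    set N : ℝ := (((typeClass z).filter fun w => Prod.snd ∘ w = y).card : ℝ)
    have hN : (2 : ℝ) ^ (n * shannonEntropy (vecType y) - Fintype.card Y * e) * N ≤
        2 ^ (n * shannonEntropy (vecType z) + e) := by
      refine le_trans ?_ h1
      rw [hcomp']
      exact mul_le_mul_of_nonneg_right h2 (Nat.cast_nonneg _)
    have hN2 : N ≤ 2 ^ (n * shannonEntropy (vecType z) + e -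
        (n * shannonEntropy (vecType y) - Fintype.card Y * e)) := by
      rw [Real.rpow_sub (by norm_num), le_div_iff₀ (by positivity), mul_comm]
      exact hN
    refine hN2.trans ?_
    calc _ ≤ (2 : ℝ) ^ (-(n * A.minInfo (vecType v)) +
            (1 + Fintype.card Y + Fintype.card X) * e +
            (n * shannonEntropy (vecType v) - Fintype.card X * e)) := by
          refine Real.rpow_le_rpow_of_exponent_le (by norm_num) ?_
          have := mul_le_mul_of_nonneg_left hI (Nat.cast_nonneg n : (0 : ℝ) ≤ n)
          linarith
      _ ≤ D := by
          rw [Real.rpow_add (by norm_num)]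
          exact mul_le_mul_of_nonneg_left h3 (by positivity)
  have hcard : ((A.reaching v y).card : ℝ) ≤
      ((A.reaching v y).image fun x' => vecType fun i => (x' i, y i)).card * D := by
    rw [Finset.card_eq_sum_card_image (fun x' : Fin n → X => vecType fun i => (x' i, y i)),
      ← nsmul_eq_mul]
    push_cast
    refine Finset.sum_le_card_nsmul _ _ _ fun b hb => ?_
    obtain ⟨x, hx, rfl⟩ := Finset.mem_image.1 hb
    exact key x hx
  have hD0 : 0 ≤ D := by positivity
  have hcard2 : (((A.reaching v y).image fun x' => vecType fun i => (x' i, y i)).card : ℝ) ≤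
      2 ^ ((Fintype.card (X × Y) : ℝ) * e) := by
    refine le_trans ?_ (natCast_succ_pow_le n _)
    refine Nat.cast_le.2 (le_trans (Finset.card_le_card ?_) (card_image_vecType_le
      ((A.reaching v y).image fun x' i => (x' i, y i))))
    rw [Finset.image_image]
    rfl
  refine hcard.trans ((mul_le_mul_of_nonneg_right hcard2 hD0).trans (le_of_eq ?_))
  rw [hD, ← mul_assoc, ← Real.rpow_add (by norm_num)]
  congr 2
  ring

lemma compositionCodes_eq {n : ℕ} (M : ℕ) (v : Fin n → X) :
    compositionCodes n M (vecType v) = Fintype.piFinset fun _ : Fin M => typeClass v := by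
  ext c
  simp [compositionCodes, Fintype.mem_piFinset, mem_typeClass]

lemma compositionCodes_card_pos {n : ℕ} (M : ℕ) (v : Fin n → X) :
    0 < (compositionCodes n M (vecType v)).card :=
  Finset.card_pos.2 ⟨fun _ => v, by simp [compositionCodes]⟩

/-- Union bound over an output and an `L`-set of messages. For fixed choices the bad codes form a
product set, which is the independence of the codewords. -/
lemma one_sub_le_probListDecodable (A : AdversarialChannel X S Y) {n : ℕ} (M L : ℕ)
    (v : Fin n → X) {β : ℝ} (hβ0 : 0 ≤ β)
    (hβ : ∀ y, ((A.reaching v y).card : ℝ) ≤ β * (typeClass v).card) :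
    1 - (Fintype.card Y : ℝ) ^ n * (M : ℝ) ^ L * β ^ L ≤
      A.probListDecodable n M (vecType v) L := by
  set t : ℝ := ((typeClass v).card : ℝ) with ht
  have ht0 : 0 ≤ t := Nat.cast_nonneg _
  have hpos : (0 : ℝ) < (compositionCodes n M (vecType v)).card := by
    exact_mod_cast compositionCodes_card_pos M v
  have htot : ((compositionCodes n M (vecType v)).card : ℝ) = t ^ M := by
    rw [compositionCodes_eq, Fintype.card_piFinset]
    simp [ht]
  have hsplit := Finset.card_filter_add_card_filter_not
    (s := compositionCodes n M (vecType v)) (fun c => A.IsListDecodable c L)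
  have hsplit' : (((compositionCodes n M (vecType v)).filter
      fun c => A.IsListDecodable c L).card : ℝ) +
      ((compositionCodes n M (vecType v)).filter fun c => ¬ A.IsListDecodable c L).card =
      (compositionCodes n M (vecType v)).card := by exact_mod_cast hsplit
  have hbad : (((compositionCodes n M (vecType v)).filter
      fun c => ¬ A.IsListDecodable c L).card : ℝ) ≤
      (Fintype.card Y : ℝ) ^ n * (M : ℝ) ^ L * β ^ L * t ^ M := by
    set I : Finset ((Fin n → Y) × Finset (Fin M)) :=
      Finset.univ ×ˢ Finset.powersetCard L Finset.univ with hI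
    have hsub : ((compositionCodes n M (vecType v)).filter fun c => ¬ A.IsListDecodable c L) ⊆
        I.biUnion fun p => Fintype.piFinset fun m =>
          if m ∈ p.2 then A.reaching v p.1 else typeClass v := by
      intro c hc
      obtain ⟨hc1, hc2⟩ := Finset.mem_filter.1 hc
      rw [compositionCodes_eq, Fintype.mem_piFinset] at hc1
      unfold IsListDecodable at hc2
      push Not at hc2
      obtain ⟨T, hT, y, s, hs⟩ := hc2
      refine Finset.mem_biUnion.2 ⟨(y, T), ?_, ?_⟩
      · simp [hI, Finset.mem_powersetCard, hT]
      · rw [Fintype.mem_piFinset]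
        intro m
        split_ifs with hm
        · exact Finset.mem_filter.2 ⟨hc1 m, s m, hs m hm⟩
        · exact hc1 m
    have hIcard : (I.card : ℝ) ≤ (Fintype.card Y : ℝ) ^ n * (M : ℝ) ^ L := by
      rw [hI, Finset.card_product, Finset.card_powersetCard]
      simp only [Finset.card_univ, Fintype.card_fin, Fintype.card_fun]
      push_cast
      refine mul_le_mul_of_nonneg_left ?_ (by positivity)
      exact_mod_cast Nat.choose_le_pow M L
    have hone : ∀ p ∈ I, ((Fintype.piFinset fun m =>
        if m ∈ p.2 then A.reaching v p.1 else typeClass v).card : ℝ) ≤ β ^ L * t ^ M := by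
      intro p hp
      have hpL : p.2.card = L := (Finset.mem_powersetCard.1 (Finset.mem_product.1 hp).2).2
      rw [Fintype.card_piFinset]
      push_cast
      calc ∏ m, (((if m ∈ p.2 then A.reaching v p.1 else typeClass v).card : ℕ) : ℝ)
          ≤ ∏ m : Fin M, (if m ∈ p.2 then β else 1) * t := by
            refine Finset.prod_le_prod (fun _ _ => Nat.cast_nonneg _) fun m _ => ?_
            split_ifs
            · exact hβ _
            · rw [one_mul]
        _ = β ^ L * t ^ M := by
            rw [Finset.prod_mul_distrib, Finset.prod_ite, ← hpL]
            simp
    calc _ ≤ ((I.biUnion fun p => Fintype.piFinset fun m =>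
          if m ∈ p.2 then A.reaching v p.1 else typeClass v).card : ℝ) :=
          Nat.cast_le.2 (Finset.card_le_card hsub)
      _ ≤ ∑ p ∈ I, ((Fintype.piFinset fun m =>
          if m ∈ p.2 then A.reaching v p.1 else typeClass v).card : ℝ) := by
          exact_mod_cast Finset.card_biUnion_le
      _ ≤ I.card • (β ^ L * t ^ M) := Finset.sum_le_card_nsmul _ _ _ hone
      _ ≤ _ := by
          rw [nsmul_eq_mul, ← mul_assoc]
          refine mul_le_mul_of_nonneg_right ?_ (by positivity)
          exact mul_le_mul_of_nonneg_right hIcard (by positivity)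
  rw [probListDecodable, le_div_iff₀ hpos, sub_mul, one_mul]
  rw [← htot] at hbad
  linarith

/-- Random codes of composition near a maximizer, of rate below capacity by `δ`, fail to be list
decodable with exponentially small probability. -/
lemma exists_probListDecodable_ge (A : AdversarialChannel X S Y) (hS : A.noiseSet.Nonempty)
    {P : X → ℝ} (hP : P ∈ A.inputSet) (hPC : A.minInfo P = A.listCapacity) {δ : ℝ} {L : ℕ}
    (hL : 1 + Real.logb 2 (Fintype.card Y) ≤ L * δ) (k : ℝ) {ζ : ℝ} (hζ : 0 < ζ) :
    ∃ η : ℝ, 0 < η ∧ ∃ n₀ : ℕ, ∀ n : ℕ, n₀ ≤ n →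
      ∀ v : Fin n → X, vecType v ∈ A.inputSet → dist (vecType v) P ≤ η →
        ∀ M : ℕ, (M : ℝ) ≤ 2 ^ (k + n * (A.listCapacity - δ)) →
          1 - (2 : ℝ) ^ (-((n : ℝ) * (1 - ζ))) ≤ A.probListDecodable n M (vecType v) L := by
  have hYpos : (0 : ℝ) < Fintype.card Y := by
    have hsum := (A.inputSet_subset hP).2
    obtain ⟨q, hq⟩ := hS
    have hsum' := (A.noiseSet_subset hq).2
    have hXne : Nonempty X := by
      by_contra h
      rw [not_nonempty_iff] at h
      simp at hsum
    have hSne : Nonempty S := by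
      by_contra h
      rw [not_nonempty_iff] at h
      simp at hsum'
    have : Nonempty Y := ⟨A.W hXne.some hSne.some⟩
    exact_mod_cast Fintype.card_pos
  set K : ℝ := Fintype.card (X × Y) + (1 + Fintype.card Y + Fintype.card X) with hK
  have hL1 : (0 : ℝ) < L + 1 := by positivity
  -- The allowance `ζ` is split in three: deviation of `minInfo` from capacity, polynomial factors,
  -- and the factor `2 ^ k` in the number of codewords. Dividing by `L + 1` avoids a case `L = 0`.
  obtain ⟨η, hη, hηP⟩ := A.minInfo_uniform hS (ε := ζ / 3 / (L + 1)) (by positivity)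
  obtain ⟨n₁, hn₁⟩ := exists_typeError_le (L * K) (ζ / 3) (by positivity)
  obtain ⟨n₂, hn₂⟩ := exists_nat_ge (L * k / (ζ / 3))
  refine ⟨η, hη, max n₁ n₂, fun n hn v hv hd M hM => ?_⟩
  have e1 := hn₁ n (le_of_max_le_left hn)
  have e2 : L * k ≤ ζ / 3 * n := by
    have : L * k / (ζ / 3) ≤ n := hn₂.trans (by exact_mod_cast le_of_max_le_right hn)
    rw [div_le_iff₀ (by positivity)] at this
    linarith
  have e3 : A.listCapacity ≤ A.minInfo (vecType v) + ζ / 3 / (L + 1) := by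
    rw [← hPC]
    exact hηP _ (A.inputSet_subset hv) _ (A.inputSet_subset hP) hd
  have e4 : L * (ζ / 3 / (L + 1)) ≤ ζ / 3 := by
    rw [mul_div_assoc', div_le_iff₀ hL1]
    nlinarith
  refine le_trans ?_ (A.one_sub_le_probListDecodable M L v (by positivity)
    (A.card_reaching_le hS v hv))
  rw [← hK]
  refine sub_le_sub_left ?_ 1
  have hY : (Fintype.card Y : ℝ) ^ n = 2 ^ (n * Real.logb 2 (Fintype.card Y)) := by
    rw [mul_comm, Real.rpow_mul (by norm_num), Real.rpow_logb (by norm_num) (by norm_num) hYpos,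
      Real.rpow_natCast]
  have hM' : (M : ℝ) ^ L ≤ 2 ^ (L * (k + n * (A.listCapacity - δ))) := by
    rw [mul_comm, Real.rpow_mul (by norm_num), Real.rpow_natCast]
    gcongr
  have hβ : ((2 : ℝ) ^ (-(n * A.minInfo (vecType v)) + K * typeError n)) ^ L =
      2 ^ (L * (-(n * A.minInfo (vecType v)) + K * typeError n)) := by
    rw [mul_comm (L : ℝ), Real.rpow_mul (by norm_num), Real.rpow_natCast]
  rw [hY, hβ]
  calc _ ≤ (2 : ℝ) ^ (n * Real.logb 2 (Fintype.card Y)) *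
        2 ^ (L * (k + n * (A.listCapacity - δ))) *
        2 ^ (L * (-(n * A.minInfo (vecType v)) + K * typeError n)) := by gcongr
    _ = 2 ^ (n * Real.logb 2 (Fintype.card Y) + L * (k + n * (A.listCapacity - δ)) +
        L * (-(n * A.minInfo (vecType v)) + K * typeError n)) := by
      rw [Real.rpow_add (by norm_num), Real.rpow_add (by norm_num)]
    _ ≤ _ := by
      -- Since `L * δ ≥ 1 + log |Y|`, the leading terms amount to at most `-n`; the three errors add
      -- at most `ζ * n`.
      refine Real.rpow_le_rpow_of_exponent_le (by norm_num) ?_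
      have hn0 : (0 : ℝ) ≤ n := Nat.cast_nonneg n
      have f1 := mul_le_mul_of_nonneg_left hL hn0
      have f2 := mul_le_mul_of_nonneg_left e3 (mul_nonneg hn0 (Nat.cast_nonneg L : (0 : ℝ) ≤ L))
      have f3 := mul_le_mul_of_nonneg_left e4 hn0
      nlinarith

lemma natCeil_rpow_le {a : ℝ} (ha : 0 ≤ a) :
    (⌈(2 : ℝ) ^ a⌉₊ : ℝ) ≤ 2 ^ (1 + a) := by
  have h1 : (1 : ℝ) ≤ 2 ^ a := Real.one_le_rpow (by norm_num) ha
  have h2 := Nat.ceil_lt_add_one (a := (2 : ℝ) ^ a) (by positivity)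
  rw [Real.rpow_add (by norm_num), Real.rpow_one]
  linarith

lemma random_codes (A : AdversarialChannel X S Y) (hS : A.noiseSet.Nonempty)
    {P : X → ℝ} (hP : P ∈ A.inputSet) (hPC : A.minInfo P = A.listCapacity) {δ : ℝ}
    (hδ : 0 < δ) (hδC : δ ≤ A.listCapacity) :
    ∃ η : ℝ, 0 < η ∧ ∃ κ : ℝ, 0 < κ ∧ ∃ n₀ : ℕ, ∀ n : ℕ, n₀ ≤ n →
      ∀ v : Fin n → X, vecType v ∈ A.inputSet → dist (vecType v) P ≤ η →
        1 - (2 : ℝ) ^ (-((n : ℝ) * (1 - (A.listCapacity - δ)))) ≤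
            A.probListDecodable n ⌈(2 : ℝ) ^ ((n : ℝ) * (A.listCapacity - δ))⌉₊ (vecType v)
              ⌈(1 + Real.logb 2 (Fintype.card Y)) / δ⌉₊ ∧
        1 - (2 : ℝ) ^ (-(κ * (n : ℝ))) ≤
            A.probListDecodable n ⌈(2 : ℝ) ^ ((n : ℝ) * (A.listCapacity - δ))⌉₊ (vecType v)
              ⌈(1 + Real.logb 2 (Fintype.card Y)) / δ⌉₊ := by
  set L := ⌈(1 + Real.logb 2 (Fintype.card Y)) / δ⌉₊ with hL
  have hLδ : 1 + Real.logb 2 (Fintype.card Y) ≤ L * δ := by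
    rw [← div_le_iff₀ hδ]; exact Nat.le_ceil _
  -- At rate zero there is one codeword and `L ≥ 2`, so nothing can fail; a positive rate is needed
  -- below to have `ζ > 0`.
  rcases hδC.eq_or_lt with h | h
  · have hL2 : 1 < L := by
      rw [hL, Nat.lt_ceil, Nat.cast_one, lt_div_iff₀ hδ]
      linarith [A.listCapacity_le ⟨P, hP⟩ hS]
    refine ⟨1, one_pos, 1, one_pos, 0, fun n _ v _ _ => ?_⟩
    have hM : ⌈(2 : ℝ) ^ ((n : ℝ) * (A.listCapacity - δ))⌉₊ = 1 := by
      rw [h]; simp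
    rw [hM]
    have hall : A.probListDecodable n 1 (vecType v) L = 1 := by
      rw [probListDecodable, Finset.filter_true_of_mem]
      · exact div_self (by exact_mod_cast (compositionCodes_card_pos 1 v).ne')
      · intro c _ T hT
        have := T.card_le_univ
        rw [Fintype.card_fin] at this
        omega
    rw [hall]
    constructor <;> linarith [Real.rpow_pos_of_pos (two_pos : (0 : ℝ) < 2)
      (-((n : ℝ) * (1 - (A.listCapacity - δ)))), Real.rpow_pos_of_pos (two_pos : (0 : ℝ) < 2)
      (-(1 * (n : ℝ)))]
  · have hR : 0 < A.listCapacity - δ := sub_pos.2 h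
    -- The exponent `1 - ζ` dominates both `1 - R` and `κ = 1 / 2`; `k = 1` absorbs the ceiling.
    obtain ⟨η, hη, n₀, hn₀⟩ := A.exists_probListDecodable_ge hS hP hPC hLδ 1
      (ζ := min (A.listCapacity - δ) (1 / 2)) (by positivity)
    refine ⟨η, hη, 1 / 2, by norm_num, n₀, fun n hn v hv hd => ?_⟩
    have hn' : (0 : ℝ) ≤ n := Nat.cast_nonneg n
    have key := hn₀ n hn v hv hd _ (natCeil_rpow_le (mul_nonneg hn' hR.le))
    constructor
    · refine le_trans (sub_le_sub_left (Real.rpow_le_rpow_of_exponent_le (by norm_num) ?_) 1) key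
      nlinarith [min_le_left (A.listCapacity - δ) (1 / 2)]
    · refine le_trans (sub_le_sub_left (Real.rpow_le_rpow_of_exponent_le (by norm_num) ?_) 1) key
      nlinarith [min_le_right (A.listCapacity - δ) (1 / 2)]

/-! ### Achievability -/

/-- Removing repetitions from a list decodable family. -/
lemma IsListDecodable.image (A : AdversarialChannel X S Y) {n M L : ℕ} {c : Fin M → Fin n → X}
    (h : A.IsListDecodable c L) (hs : (A.admissibleNoise n).Nonempty) :
    M ≤ L * (Finset.univ.image c).card ∧
      A.IsListDecodable (fun m : (Finset.univ.image c : Finset (Fin n → X)) => (m : Fin n → X))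
        L := by
  constructor
  -- Equal codewords are confusable by any one admissible noise vector, so no word is repeated more
  -- than `L` times.
  · have := Finset.card_le_mul_card_image (f := c) Finset.univ L (fun x _ => by
      by_contra hlt
      push Not at hlt
      obtain ⟨T, hT, hTL⟩ := Finset.exists_subset_card_eq hlt.le
      obtain ⟨s, hs⟩ := hs
      refine h T hTL ⟨A.transmit x s, fun _ => s, fun m hm => ⟨hs, ?_⟩⟩
      rw [(Finset.mem_filter.1 (hT hm)).2])
    simpa using this
  · rintro T hT ⟨y, s, hys⟩
    have hex : ∀ x : (Finset.univ.image c : Finset (Fin n → X)), ∃ m, c m = x := fun x => by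
      obtain ⟨m, -, hm⟩ := Finset.mem_image.1 x.2
      exact ⟨m, hm⟩
    choose g hg using hex
    have hginj : Function.Injective g := fun x x' hxx => by
      apply Subtype.ext
      rw [← hg x, ← hg x', hxx]
    let s' : Fin M → Fin n → S := fun m => s ⟨c m, Finset.mem_image_of_mem _ (Finset.mem_univ _)⟩
    refine h (T.image g) ((Finset.card_image_of_injective T hginj).trans hT) ⟨y, s', ?_⟩
    intro m hm
    obtain ⟨x, hx, rfl⟩ := Finset.mem_image.1 hm
    have : s' (g x) = s x := congrArg s (Subtype.ext (hg x))
    rw [this, hg]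
    exact hys x hx

lemma achievability (A : AdversarialChannel X S Y) (hX : A.inputSet.Nonempty)
    (hS : A.noiseSet.Nonempty) {N : Set ℕ} (hXN : TypesAsymptoticallyDense N A.inputSet)
    (hSN : TypesAsymptoticallyDense N A.noiseSet) {δ : ℝ} (hδ : 0 < δ) (hδC : δ ≤ A.listCapacity) :
    ∃ n₀ : ℕ, ∀ n ∈ N, n₀ ≤ n →
      ∃ C : Finset (Fin n → X), (∀ x ∈ C, x ∈ A.admissibleInputs n) ∧
        (2 : ℝ) ^ ((n : ℝ) * (A.listCapacity - δ)) ≤ (C.card : ℝ) ∧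
        A.IsListDecodable (fun m : C => (m : Fin n → X))
          ⌈(1 + Real.logb 2 (Fintype.card Y)) / δ⌉₊ := by
  obtain ⟨P, hP, hPC⟩ := (A.isGreatest_listCapacity hX hS).1
  obtain ⟨q, hq⟩ := id hS
  set L := ⌈(1 + Real.logb 2 (Fintype.card Y)) / δ⌉₊ with hL
  have hLδ : 1 + Real.logb 2 (Fintype.card Y) ≤ L * δ := by
    rw [← div_le_iff₀ hδ]; exact Nat.le_ceil _
  have hLpos : 0 < L := by
    rw [hL, Nat.ceil_pos]
    have := A.listCapacity_le hX hS
    exact div_pos (by linarith) hδ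
  have hLpos' : (0 : ℝ) < L := by exact_mod_cast hLpos
  -- `L` times too many codewords are drawn, to survive the removal of repetitions; `k` pays for
  -- this factor and for the ceiling.
  obtain ⟨η, hη, n₁, hn₁⟩ := A.exists_probListDecodable_ge hS hP hPC hLδ
    (Real.logb 2 L + 1) (ζ := 1 / 2) (by norm_num)
  obtain ⟨n₂, hn₂⟩ := hXN P hP η hη
  obtain ⟨n₃, hn₃⟩ := hSN q hq 1 one_pos
  refine ⟨max (max n₁ n₂) (max n₃ 1), fun n hnN hn => ?_⟩
  simp only [max_le_iff] at hn
  obtain ⟨v, hv, hvd⟩ := hn₂ n hnN hn.1.2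
  obtain ⟨s, hs, -⟩ := hn₃ n hnN hn.2.1
  have hn' : (1 : ℝ) ≤ n := by exact_mod_cast hn.2.2
  have hR : 0 ≤ (n : ℝ) * (A.listCapacity - δ) := mul_nonneg (by linarith) (by linarith)
  have key := hn₁ n hn.1.1 v hv hvd.le (L * ⌈(2 : ℝ) ^ ((n : ℝ) * (A.listCapacity - δ))⌉₊) (by
    rw [add_assoc, Real.rpow_add (by norm_num), Real.rpow_logb (by norm_num) (by norm_num) hLpos']
    push_cast
    exact mul_le_mul_of_nonneg_left (natCeil_rpow_le hR) hLpos'.le)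
  have hlt : (2 : ℝ) ^ (-((n : ℝ) * (1 - 1 / 2))) < 1 :=
    Real.rpow_lt_one_of_one_lt_of_neg (by norm_num) (by linarith)
  have hpos : 0 < A.probListDecodable n (L * ⌈(2 : ℝ) ^ ((n : ℝ) * (A.listCapacity - δ))⌉₊)
    (vecType v) L := by linarith
  have hne : ((compositionCodes n (L * ⌈(2 : ℝ) ^ ((n : ℝ) * (A.listCapacity - δ))⌉₊)
      (vecType v)).filter fun c => A.IsListDecodable c L).Nonempty := by
    by_contra hcon
    rw [Finset.not_nonempty_iff_eq_empty] at hcon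
    rw [probListDecodable, hcon] at hpos
    simp at hpos
  obtain ⟨c, hc⟩ := hne
  obtain ⟨hc1, hc2⟩ := Finset.mem_filter.1 hc
  obtain ⟨h1, h2⟩ := IsListDecodable.image A hc2 ⟨s, hs⟩
  refine ⟨Finset.univ.image c, ?_, ?_, h2⟩
  · intro x hx
    obtain ⟨m, -, rfl⟩ := Finset.mem_image.1 hx
    have : vecType (c m) = vecType v := (Finset.mem_filter.1 hc1).2 m
    change vecType (c m) ∈ A.inputSet
    rw [this]; exact hv
  · refine (Nat.le_ceil _).trans ?_
    exact_mod_cast Nat.le_of_mul_le_mul_left h1 hLpos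

end AdversarialChannel

/-! ### Converse -/

/-- The noise distribution to be approximated will depend on the code, so the threshold must not
depend on the point; a finite cover by balls provides this. -/
lemma TypesAsymptoticallyDense.uniform {B : Type*} [Fintype B] {N : Set ℕ} {lam : Set (B → ℝ)}
    (h : TypesAsymptoticallyDense N lam) (hc : IsCompact lam) {ε : ℝ} (hε : 0 < ε) :
    ∃ n₀ : ℕ, ∀ n ∈ N, n₀ ≤ n → ∀ q ∈ lam,
      ∃ v : Fin n → B, vecType v ∈ lam ∧ dist (vecType v) q < ε := by
  obtain ⟨t, hts, htf, hcov⟩ := hc.finite_cover_balls (half_pos hε)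
  have hev : ∀ᶠ n : ℕ in Filter.atTop, ∀ p ∈ t, n ∈ N →
      ∃ v : Fin n → B, vecType v ∈ lam ∧ dist (vecType v) p < ε / 2 := by
    rw [Filter.eventually_all_finite htf]
    intro p hp
    obtain ⟨n₀, hn₀⟩ := h p (hts hp) _ (half_pos hε)
    exact Filter.eventually_atTop.2 ⟨n₀, fun n hn hnN => hn₀ n hnN hn⟩
  obtain ⟨n₀, hn₀⟩ := Filter.eventually_atTop.1 hev
  refine ⟨n₀, fun n hnN hn q hq => ?_⟩
  obtain ⟨p, hp, hqp⟩ := Set.mem_iUnion₂.1 (hcov hq)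
  obtain ⟨v, hv, hvd⟩ := hn₀ n hn p hp hnN
  refine ⟨v, hv, (dist_triangle _ p _).trans_lt ?_⟩
  rw [Metric.mem_ball, dist_comm] at hqp
  linarith

/-! ### Rounding joint distributions to joint types with prescribed margins -/

section Margins

variable {X S : Type*} [Fintype X] [Fintype S] {n : ℕ}

lemma letterCount_fst (z : Fin n → X × S) (x : X) :
    ∑ s, letterCount z (x, s) = letterCount (Prod.fst ∘ z) x := by
  rw [letterCount_comp, Fintype.sum_prod_type, Finset.sum_eq_single x]
  · simp
  · intro x' _ h; simp [h]
  · simp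

lemma letterCount_snd (z : Fin n → X × S) (s : S) :
    ∑ x, letterCount z (x, s) = letterCount (Prod.snd ∘ z) s := by
  rw [letterCount_comp, Fintype.sum_prod_type_right, Finset.sum_eq_single s]
  · simp
  · intro x' _ h; simp [h]
  · simp

/-- A natural matrix dominated by given margins can be enlarged to one with exactly
these margins. -/
lemma exists_matrix_margins {K : X × S → ℕ} {a : X → ℕ} {b : S → ℕ}
    (ha : ∀ x, ∑ s, K (x, s) ≤ a x) (hb : ∀ s, ∑ x, K (x, s) ≤ b s)
    (hab : ∑ x, a x = ∑ s, b s) :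
    ∃ G : X × S → ℕ, (∀ p, K p ≤ G p) ∧ (∀ x, ∑ s, G (x, s) = a x) ∧
      ∀ s, ∑ x, G (x, s) = b s := by
  have h1 : ∑ x, (a x - ∑ s, K (x, s)) = ∑ s, (b s - ∑ x, K (x, s)) := by
    zify [ha, hb]
    rw [Finset.sum_sub_distrib, Finset.sum_sub_distrib,
      Finset.sum_comm (f := fun s x => (K (x, s) : ℤ))]
    have : (∑ x, (a x : ℤ)) = ∑ s, (b s : ℤ) := by exact_mod_cast hab
    rw [this]
  -- The deficits of rows and columns have the same total. Two sequences of that length with these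
  -- letter counts, paired arbitrarily, fill them.
  obtain ⟨u, hu⟩ := exists_letterCount_eq (fun x => a x - ∑ s, K (x, s)) h1
  obtain ⟨w, hw⟩ := exists_letterCount_eq (fun s => b s - ∑ x, K (x, s)) rfl
  refine ⟨fun p => K p + letterCount (fun i => (u i, w i)) p, fun p => Nat.le_add_right _ _,
    fun x => ?_, fun s => ?_⟩
  · rw [Finset.sum_add_distrib, letterCount_fst]
    have : letterCount (Prod.fst ∘ fun i => (u i, w i)) x = a x - ∑ s, K (x, s) := hu x
    rw [this]
    exact Nat.add_sub_of_le (ha x)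
  · rw [Finset.sum_add_distrib, letterCount_snd]
    have : letterCount (Prod.snd ∘ fun i => (u i, w i)) s = b s - ∑ x, K (x, s) := hw s
    rw [this]
    exact Nat.add_sub_of_le (hb s)

/-- Given a joint distribution whose first margin is the type of `x` and whose second margin is
close to the type of `w`, some vector of the type of `w` has nearly that joint type with `x`. -/
lemma exists_vecType_pair_dist_le (hn : n ≠ 0) (x : Fin n → X) (w : Fin n → S) {Q : X × S → ℝ}
    (hQ0 : ∀ p, 0 ≤ Q p) (hQx : pushForward Prod.fst Q = vecType x) {ρ : ℝ}
    (hQw : dist (vecType w) (pushForward Prod.snd Q) ≤ ρ) :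
    ∃ s : Fin n → S, vecType s = vecType w ∧
      dist (vecType fun i => (x i, s i)) Q ≤ (Fintype.card S + 1) * (ρ + 1 / n) := by
  have hn' : (0 : ℝ) < n := by positivity
  have hρ : 0 ≤ ρ := dist_nonneg.trans hQw
  have hd : ∀ b, |vecType w b - pushForward Prod.snd Q b| ≤ ρ := fun b => by
    rw [← Real.dist_eq]; exact (dist_le_pi_dist _ _ b).trans hQw
  have hrow : ∀ a, ∑ b, Q (a, b) = vecType x a := fun a => by rw [← pushForward_fst, hQx]
  have hcx : ∀ a, (letterCount x a : ℝ) = n * vecType x a := fun a => by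
    rw [vecType_apply]; field_simp
  have hcw : ∀ b, (letterCount w b : ℝ) = n * vecType w b := fun b => by
    rw [vecType_apply]; field_simp
  -- Shaving by `ρ` again, now with rounding down; the natural floor sends negative values to 0.
  -- Each entry loses at most `n * ρ + 1`, and a row has `|S|` entries.
  set K : X × S → ℕ := fun p => ⌊n * (Q p - ρ)⌋₊ with hK
  have hKle : ∀ p, (K p : ℝ) ≤ n * max (Q p - ρ) 0 := by
    intro p
    refine (Nat.floor_le_floor (mul_le_mul_of_nonneg_left (le_max_left _ 0) hn'.le) |>
      Nat.cast_le.2).trans (Nat.floor_le (by positivity))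
  have hKQ : ∀ p, (K p : ℝ) ≤ n * Q p := fun p => (hKle p).trans
    (mul_le_mul_of_nonneg_left (max_le (by linarith) (hQ0 p)) hn'.le)
  have hQK : ∀ p, n * (Q p - ρ) - 1 ≤ K p := fun p => (Nat.sub_one_lt_floor _).le
  obtain ⟨G, hKG, hGx, hGw⟩ := exists_matrix_margins (K := K) (a := letterCount x)
    (b := letterCount w)
    (fun a => by
      have : (∑ b, (K (a, b) : ℝ)) ≤ letterCount x a := by
        refine (Finset.sum_le_sum fun b _ => hKQ (a, b)).trans (le_of_eq ?_)
        rw [← Finset.mul_sum, hrow, hcx]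
      exact_mod_cast this)
    (fun b => by
      have : (∑ a, (K (a, b) : ℝ)) ≤ letterCount w b := by
        refine (Finset.sum_le_sum fun a _ => hKle (a, b)).trans ?_
        rw [← Finset.mul_sum, hcw]
        refine mul_le_mul_of_nonneg_left ?_ hn'.le
        refine (sum_max_sub_le (a := fun a => Q (a, b)) (fun a => hQ0 _) hρ).trans ?_
        rw [← pushForward_snd]
        exact max_le (by linarith [(abs_le.1 (hd b)).1]) (vecType_nonneg w b)
      exact_mod_cast this)
    (by rw [sum_letterCount, sum_letterCount])
  obtain ⟨z, hz⟩ := exists_letterCount_eq (n := n) G (by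
    rw [Fintype.sum_prod_type]; simp_rw [hGx]; exact sum_letterCount x)
  have hzx : vecType x = vecType (Prod.fst ∘ z) := by
    rw [vecType_eq_iff]
    intro a
    rw [← letterCount_fst]
    simp_rw [hz, hGx]
  -- Reorder the realization `z` so that its first component becomes `x` itself.
  obtain ⟨σ, hσ⟩ := exists_perm_of_vecType_eq hzx
  refine ⟨Prod.snd ∘ z ∘ σ, ?_, ?_⟩
  · rw [← Function.comp_assoc, vecType_comp_perm, vecType_eq_iff]
    intro b
    rw [← letterCount_snd]
    simp_rw [hz, hGw]
  · have hpair : (fun i => (x i, (Prod.snd ∘ z ∘ σ) i)) = z ∘ σ := by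
      funext i
      rw [hσ]
      rfl
    rw [hpair, vecType_comp_perm, dist_pi_le_iff (by positivity)]
    rintro ⟨a, b⟩
    have hGlo : n * (Q (a, b) - ρ) - 1 ≤ G (a, b) :=
      (hQK _).trans (Nat.cast_le.2 (hKG _))
    have hres : (G (a, b) : ℝ) - K (a, b) ≤ ∑ b', ((G (a, b') : ℝ) - K (a, b')) :=
      Finset.single_le_sum (f := fun b' => (G (a, b') : ℝ) - K (a, b'))
        (fun b' _ => sub_nonneg.2 (Nat.cast_le.2 (hKG _))) (Finset.mem_univ b)
    have hG : ∑ b', (G (a, b') : ℝ) = n * vecType x a := by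
      rw [← hcx]; exact_mod_cast hGx a
    have hKlo : ∑ b', (n * (Q (a, b') - ρ) - 1) ≤ ∑ b', (K (a, b') : ℝ) :=
      Finset.sum_le_sum fun b' _ => hQK (a, b')
    rw [Finset.sum_sub_distrib, ← Finset.mul_sum, Finset.sum_sub_distrib, hrow] at hKlo
    simp only [Finset.sum_const, Finset.card_univ, nsmul_eq_mul] at hKlo
    rw [Finset.sum_sub_distrib, hG] at hres
    have hKup := hKQ (a, b)
    have hG' : (letterCount z (a, b) : ℝ) = G (a, b) := by rw [hz]
    have hS0 : 0 ≤ (Fintype.card S : ℝ) * (n * ρ + 1) := by positivity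
    have e1 : |(G (a, b) : ℝ) - n * Q (a, b)| ≤ (Fintype.card S + 1) * (n * ρ + 1) := by
      rw [abs_le]
      have : 0 ≤ n * ρ := by positivity
      constructor <;> linarith
    rw [Real.dist_eq, vecType_apply, hG']
    have e2 : (G (a, b) : ℝ) / n - Q (a, b) = (G (a, b) - n * Q (a, b)) / n := by field_simp
    rw [e2, abs_div, abs_of_pos hn', div_le_iff₀ hn']
    refine e1.trans (le_of_eq ?_)
    field_simp

end Margins

/-! ### Large lists by double counting -/

namespace AdversarialChannel

variable {X S Y : Type*} [Fintype X] [Fintype S] [Fintype Y]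

/-- Averaging over the outputs of the type of `A.transmit x s` yields a large list. -/
lemma exists_outputList_card_mul_ge (A : AdversarialChannel X S Y) {n : ℕ} (x : Fin n → X)
    {s : Fin n → S} (hs : s ∈ A.admissibleNoise n) (C : Finset (Fin n → X))
    (hC : ∀ x' ∈ C, vecType x' = vecType x) :
    ∃ y : Fin n → Y, C.card * (typeClass fun i => (x i, A.transmit x s i)).card ≤
      (A.outputList C y).card * ((typeClass x).card * (typeClass (A.transmit x s)).card) := by
  set y₀ := A.transmit x s with hy₀
  set z : Fin n → X × Y := fun i => (x i, y₀ i) with hz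
  let r : (Fin n → X) → (Fin n → Y) → Prop := fun x' y => (vecType fun i => (x' i, y i)) = vecType z
  have hdeg : ∀ x' ∈ C, (typeClass z).card ≤
      (typeClass x).card * ((typeClass y₀).filter fun y => r x' y).card := by
    intro x' hx'
    have h := typeClass_card_comp Prod.fst z (y := x') (hC x' hx')
    have hzx : Prod.fst ∘ z = x := rfl
    rw [hzx] at h
    rw [h]
    refine Nat.mul_le_mul_left _ (Finset.card_le_card_of_injOn (fun w => Prod.snd ∘ w) ?_ ?_)
    · intro w hw
      simp only [Finset.coe_filter, Set.mem_ofPred_eq, mem_typeClass] at hw ⊢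
      constructor
      · have hzy : Prod.snd ∘ z = y₀ := rfl
        rw [← hzy, vecType_comp, vecType_comp, hw.1]
      · have : (fun i => (x' i, (Prod.snd ∘ w) i)) = w := by
          funext i; rw [← hw.2]; rfl
        change vecType _ = _
        rw [this, hw.1]
    · intro w hw w' hw' heq
      simp only [Finset.coe_filter, Set.mem_ofPred_eq] at hw hw'
      funext i
      exact Prod.ext (congrFun (hw.2.trans hw'.2.symm) i) (congrFun heq i)
  have hlist : ∀ y, (C.filter fun x' => r x' y).card ≤ (A.outputList C y).card := by
    intro y
    refine Finset.card_le_card fun x' hx' => ?_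
    obtain ⟨hx'C, hr⟩ := Finset.mem_filter.1 hx'
    -- Pairs of equal joint type differ by a permutation, and the permuted noise is still
    -- admissible.
    obtain ⟨σ, hσ⟩ := exists_perm_of_vecType_eq hr
    refine Finset.mem_filter.2 ⟨hx'C, s ∘ σ, ?_, ?_⟩
    · change vecType (s ∘ σ) ∈ A.noiseSet
      rw [vecType_comp_perm]; exact hs
    · funext i
      have h1 := congrArg Prod.fst (congrFun hσ i)
      have h2 := congrArg Prod.snd (congrFun hσ i)
      simp only [hz, Function.comp] at h1 h2
      rw [h2, transmit, h1]
      rfl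
  have hdouble := Finset.sum_card_bipartiteAbove_eq_sum_card_bipartiteBelow
    (s := C) (t := typeClass y₀) r
  simp only [Finset.bipartiteAbove, Finset.bipartiteBelow] at hdouble
  by_contra hcon
  push Not at hcon
  have h1 : C.card * (typeClass z).card ≤
      (typeClass x).card * ∑ y ∈ typeClass y₀, (C.filter fun x' => r x' y).card := by
    rw [← hdouble, Finset.mul_sum, ← smul_eq_mul]
    exact Finset.card_nsmul_le_sum _ _ _ hdeg
  have hx0 := typeClass_card_pos x
  have h2 : (typeClass y₀).card * ((typeClass x).card *
      ∑ y ∈ typeClass y₀, (C.filter fun x' => r x' y).card) <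
      (typeClass y₀).card * (C.card * (typeClass z).card) := by
    rw [Finset.mul_sum, Finset.mul_sum, ← smul_eq_mul (typeClass y₀).card (C.card * _),
      ← Finset.sum_const]
    refine Finset.sum_lt_sum_of_nonempty ⟨y₀, mem_typeClass.2 rfl⟩ fun y _ => ?_
    refine lt_of_le_of_lt ?_ (hcon y)
    calc _ = (C.filter fun x' => r x' y).card * ((typeClass x).card * (typeClass y₀).card) := by
          ring
      _ ≤ _ := Nat.mul_le_mul_right _ (hlist y)
  exact absurd (Nat.mul_le_mul_left (typeClass y₀).card h1) (not_le.2 h2)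

lemma converse (A : AdversarialChannel X S Y) (hS : A.noiseSet.Nonempty) {N : Set ℕ}
    (hSN : TypesAsymptoticallyDense N A.noiseSet) {c : ℝ} (hc : c < 1) {δ : ℝ} (hδ : 0 < δ) :
    ∃ n₀ : ℕ, ∀ n ∈ N, n₀ ≤ n →
      ∀ C : Finset (Fin n → X), (∀ x ∈ C, x ∈ A.admissibleInputs n) →
        (2 : ℝ) ^ ((n : ℝ) * (A.listCapacity + δ)) ≤ (C.card : ℝ) →
        ∃ y : Fin n → Y, (2 : ℝ) ^ (c * (n : ℝ) * δ) ≤ ((A.outputList C y).card : ℝ) := by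
  -- The spare exponent `(1 - c) * δ` is halved: one half for the excess of the information over
  -- capacity, one for polynomial factors.
  set ε := (1 - c) * δ / 2 with hε
  have hε0 : 0 < ε := half_pos (mul_pos (by linarith) hδ)
  obtain ⟨r, hr, hunif⟩ := A.jointInfo_uniform hε0
  -- With `1 / n ≤ ρ`, the rounding error is at most `(|S| + 1) * 2 * ρ = r / 2`.
  set ρ := r / (4 * (Fintype.card S + 1)) with hρ
  have hρ0 : 0 < ρ := by positivity
  have hcompact : IsCompact A.noiseSet :=
    (isCompact_stdSimplex ℝ S).of_isClosed_subset A.noiseSet_closed A.noiseSet_subset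
  obtain ⟨n₁, hn₁⟩ := hSN.uniform hcompact hρ0
  -- Errors to come: `|X|` from the choice of a type, `|X × Y|` from the joint type class, 1 from
  -- each of the classes of input and output.
  set K : ℝ := Fintype.card X + Fintype.card (X × Y) + 2 with hK
  obtain ⟨n₂, hn₂⟩ := exists_typeError_le K ε hε0
  obtain ⟨n₃, hn₃⟩ := exists_nat_ge (1 / ρ)
  refine ⟨max (max n₁ n₂) (max n₃ 1), fun n hnN hn C hC hcard => ?_⟩
  simp only [max_le_iff] at hn
  have hn0 : n ≠ 0 := by omega
  have hnpos : (0 : ℝ) < n := by positivity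
  have hinv : 1 / (n : ℝ) ≤ ρ := by
    have : 1 / ρ ≤ n := hn₃.trans (by exact_mod_cast hn.2.1)
    rw [div_le_iff₀ hρ0] at this
    rw [div_le_iff₀ hnpos]
    linarith
  set e := typeError n with he
  have hCne : C.Nonempty := by
    rw [← Finset.card_pos]
    exact_mod_cast (Real.rpow_pos_of_pos two_pos _).trans_le hcard
  have hine : (C.image vecType).Nonempty := hCne.image _
  have hi0 : (0 : ℝ) < (C.image vecType).card := by exact_mod_cast Finset.card_pos.2 hine
  -- Pigeonhole: some type retains at least an average share of the code.
  obtain ⟨τ, hτ, hτC⟩ := Finset.exists_le_card_fiber_of_nsmul_le_card_of_maps_to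
    (s := C) (t := C.image vecType) (f := vecType)
    (b := (C.card : ℝ) / (C.image vecType).card) (fun x hx => Finset.mem_image_of_mem _ hx) hine
    (by rw [nsmul_eq_mul, mul_div_cancel₀ _ hi0.ne'])
  obtain ⟨x, hx, rfl⟩ := Finset.mem_image.1 hτ
  have hxA : vecType x ∈ A.inputSet := hC x hx
  have hxs := A.inputSet_subset hxA
  obtain ⟨Q, hQ, hQI⟩ := A.exists_jointInfo_eq_minInfo hS hxs
  obtain ⟨w, hw, hwd⟩ := hn₁ n hnN hn.1.1 _ hQ.2.2
  obtain ⟨s, hsw, hsd⟩ := exists_vecType_pair_dist_le hn0 x w hQ.1 hQ.2.1 hwd.le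
  have hs : s ∈ A.admissibleNoise n := by
    change vecType s ∈ A.noiseSet
    rw [hsw]; exact hw
  have hI : A.jointInfo (vecType fun i => (x i, s i)) ≤ A.listCapacity + ε := by
    have h1 := hunif _ (A.noiseJoints_subset_Icc hxs (A.vecType_pair_mem_noiseJoints x hs)) Q
      (A.noiseJoints_subset_Icc hxs hQ) (by
        refine hsd.trans_lt ?_
        calc ((Fintype.card S : ℝ) + 1) * (ρ + 1 / n) ≤ (Fintype.card S + 1) * (ρ + ρ) := by
              gcongr
          _ = r / 2 := by rw [hρ]; field_simp; ring
          _ < r := by linarith)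
    rw [Real.dist_eq, hQI] at h1
    linarith [(abs_lt.1 h1).2, A.minInfo_le_listCapacity hS hxA]
  rw [A.jointInfo_vecType] at hI
  obtain ⟨y, hy⟩ := A.exists_outputList_card_mul_ge x hs
    (C.filter fun x' => vecType x' = vecType x) (fun x' hx' => (Finset.mem_filter.1 hx').2)
  refine ⟨y, ?_⟩
  set z : Fin n → X × Y := fun i => (x i, A.transmit x s i) with hz
  have hsub : ((A.outputList (C.filter fun x' => vecType x' = vecType x) y).card : ℝ) ≤
      (A.outputList C y).card :=
    Nat.cast_le.2 (Finset.card_le_card (Finset.filter_subset_filter _ (Finset.filter_subset _ _)))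
  refine le_trans ?_ hsub
  set ℓ := (A.outputList (C.filter fun x' => vecType x' = vecType x) y).card
  have hy' : ((C.filter fun x' => vecType x' = vecType x).card : ℝ) * (typeClass z).card ≤
    ℓ * ((typeClass x).card * (typeClass (A.transmit x s)).card) := by exact_mod_cast hy
  have hfib : (2 : ℝ) ^ (n * (A.listCapacity + δ) - Fintype.card X * e) ≤
      ((C.filter fun x' => vecType x' = vecType x).card : ℝ) := by
    refine le_trans ?_ hτC
    rw [Real.rpow_sub two_pos]
    refine div_le_div₀ (Nat.cast_nonneg _) hcard hi0 ?_
    exact (Nat.cast_le.2 (card_image_vecType_le C)).trans (natCast_succ_pow_le n _)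
  have hlow := rpow_le_typeClass_card z
  have hup1 := typeClass_card_le_rpow x
  have hup2 := typeClass_card_le_rpow (A.transmit x s)
  have hmain : (2 : ℝ) ^ (n * (A.listCapacity + δ) - Fintype.card X * e) *
      2 ^ (n * shannonEntropy (vecType z) - Fintype.card (X × Y) * e) ≤
      ℓ * (2 ^ (n * shannonEntropy (vecType x) + e) *
        2 ^ (n * shannonEntropy (vecType (A.transmit x s)) + e)) :=
    (mul_le_mul hfib hlow (by positivity) (by positivity)).trans (hy'.trans (by gcongr))
  rw [← Real.rpow_add two_pos, ← Real.rpow_add two_pos, ← div_le_iff₀ (by positivity),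
    ← Real.rpow_sub two_pos] at hmain
  refine le_trans (Real.rpow_le_rpow_of_exponent_le (by norm_num) ?_) hmain
  have f1 := mul_le_mul_of_nonneg_left hI hnpos.le
  have f2 : K * e ≤ ε * n := hn₂ n hn.1.2
  have f3 : ε * n + ε * n = n * δ - c * n * δ := by rw [hε]; ring
  rw [hK] at f2
  linarith

end AdversarialChannel

theorem mainTheorem3 {X S Y : Type*} [Fintype X] [Fintype S] [Fintype Y]
    (A : AdversarialChannel X S Y)
    (hX : A.inputSet.Nonempty) (hS : A.noiseSet.Nonempty)
    (N : Set ℕ)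
    (hXN : TypesAsymptoticallyDense N A.inputSet)
    (hSN : TypesAsymptoticallyDense N A.noiseSet) :
    -- the minima and the maximum in the definition of the capacity are attained
    ((∀ P ∈ A.inputSet, IsLeast (A.infoValues P) (A.minInfo P)) ∧
      IsGreatest (A.minInfo '' A.inputSet) A.listCapacity) ∧
    -- random constant-composition codes
    (∀ P ∈ A.inputSet, A.minInfo P = A.listCapacity →
      ∀ δ : ℝ, 0 < δ → δ ≤ A.listCapacity →
        ∃ η : ℝ, 0 < η ∧ ∃ κ : ℝ, 0 < κ ∧ ∃ n₀ : ℕ, ∀ n : ℕ, n₀ ≤ n →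
          ∀ v : Fin n → X, vecType v ∈ A.inputSet → dist (vecType v) P ≤ η →
            1 - (2 : ℝ) ^ (-((n : ℝ) * (1 - (A.listCapacity - δ)))) ≤
                A.probListDecodable n ⌈(2 : ℝ) ^ ((n : ℝ) * (A.listCapacity - δ))⌉₊ (vecType v)
                  ⌈(1 + Real.logb 2 (Fintype.card Y)) / δ⌉₊ ∧
            1 - (2 : ℝ) ^ (-(κ * (n : ℝ))) ≤
                A.probListDecodable n ⌈(2 : ℝ) ^ ((n : ℝ) * (A.listCapacity - δ))⌉₊ (vecType v)
                  ⌈(1 + Real.logb 2 (Fintype.card Y)) / δ⌉₊) ∧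
    -- achievability
    (∀ δ : ℝ, 0 < δ → δ ≤ A.listCapacity →
      ∃ n₀ : ℕ, ∀ n ∈ N, n₀ ≤ n →
        ∃ C : Finset (Fin n → X), (∀ x ∈ C, x ∈ A.admissibleInputs n) ∧
          (2 : ℝ) ^ ((n : ℝ) * (A.listCapacity - δ)) ≤ (C.card : ℝ) ∧
          A.IsListDecodable (fun m : C => (m : Fin n → X))
            ⌈(1 + Real.logb 2 (Fintype.card Y)) / δ⌉₊) ∧
    -- converse
    (∀ c : ℝ, c < 1 → ∀ δ : ℝ, 0 < δ →
      ∃ n₀ : ℕ, ∀ n ∈ N, n₀ ≤ n →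
        ∀ C : Finset (Fin n → X), (∀ x ∈ C, x ∈ A.admissibleInputs n) →
          (2 : ℝ) ^ ((n : ℝ) * (A.listCapacity + δ)) ≤ (C.card : ℝ) →
          ∃ y : Fin n → Y, (2 : ℝ) ^ (c * (n : ℝ) * δ) ≤ ((A.outputList C y).card : ℝ)) := by
  refine ⟨⟨fun P hP => A.isLeast_minInfo hS (A.inputSet_subset hP),
    A.isGreatest_listCapacity hX hS⟩, ?_, ?_, ?_⟩
  · intro P hP hPC δ hδ hδC
    exact A.random_codes hS hP hPC hδ hδC
  · intro δ hδ hδC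
    exact A.achievability hX hS hXN hSN hδ hδC
  · intro c hc δ hδ
    exact A.converse hS hSN hc hδ
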